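/- Let $R$ be a positive division rig: a commutative semiring with $0\neq 1$ in which every nonzero element has a multiplicative inverse and in which $x+y=0$ implies $x=y=0$. A \emph{circuit} with $m$ inputs and $n$ outputs consists of a finite set of nodes (junctions), a finite multiset of undirected edges between nodes (parallel edges and loops are allowed), each of which is either a bare wire or a resistor with a conductance $y\in R$, $y\neq 0$, and an assignment of a node to each of the $m$ inputs and each of the $n$ outputs. A node is \emph{internal} if no input or output is assigned to it. Circuits are taken up to renaming of nodes. Two circuits are composed by joining the outputs of the first to the inputs of the second by wires, and tensored by juxtaposition. Let $\mathsf{Resist}_R$ be the category whose objects are the natural numbers and whose maps $m\to n$ are the circuits with $m$ inputs and $n$ outputs, modulo the congruence (for composition and tensor product) generated by the identity laws, the spider identities (two junctions joined by a wire are amalgamated; a wire from a junction to itself is removed), self-adjointness of resistors, and the following identities: a resistor in parallel with a wire equals the wire; two parallel resistors $y,z$ equal one resistor $y+z$; for every $n\ge 0$, the star with an internal centre and arms of conductances $y_1,\dots,y_n$ to $n$ outer nodes equals the mesh on the $n$ outer nodes with conductance $y_iy_j/\sum_k y_k$ between the nodes $i\neq j$. Consider the following rewriting steps, applied anywhere in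 a circuit: \begin{itemize} \item Spider: amalgamate two different nodes joined by a wire, deleting that wire; delete a wire from a node to itself. \item Short circuit: delete a resistor that is parallel to a wire or that joins a node to itself. \item Parallel: replace two resistors $y,z$ with the same ends by one resistor $y+z$. \item $(Y/\Delta)_k$, $k\ge 0$: if $x$ is an internal node whose edges are exactly $k$ resistors $y_1,\dots,y_k$ to nodes $a_1,\dots,a_k\neq x$ (not necessarily distinct), delete $x$ and these resistors and add, for all $i<j$, a resistor $y_iy_j/\sum_l y_l$ between $a_i$ and $a_j$. \end{itemize} Let $N$ be the number of nodes of a circuit, and $P$ the number of its parallel edges, that is, of edges that are loops or have the same ends as another edge. Then, for circuits with $m$ inputs and $n$ outputs: \begin{enumerate} \item every rewriting step strictly decreases $(N,P)$ in the lexicographic order, and the rewriting system terminates; \item it is locally confluent, and it is confluent; \item a circuit is in normal form (admits no step) if and only if it is a family of meshes, that is, it has no internal node, no bare wire and no loop, and any two nodes are joined by at most one resistor; \item every circuit rewrites to exactly one normal form; \item two circuits present the same map of $\mathsf{Resist}_R$ if and only if they rewrite to a common circuit. \end{enumerate} -/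

import Mathlib

universe u

/-! ## Positive division rigs

A commutative division rig is a `Semifield`.  It is positive if a sum vanishes only when both
summands do. -/

class PositiveRig (R : Type u) [AddCommMonoid R] : Prop where
  eq_zero_of_add_eq_zero : ∀ x y : R, x + y = 0 → x = 0 ∧ y = 0

/-- The conductances: nonzero elements of the rig. -/
abbrev Conductance (R : Type u) [Semifield R] : Type u := {y : R // y ≠ 0}

namespace Conductance

variable {R : Type u} [Semifield R] [PositiveRig R]

/-- The conductance of two resistors in parallel. -/
def add (y z : Conductance R) : Conductance R :=
  ⟨y.1 + z.1, fun h => y.2 (PositiveRig.eq_zero_of_add_eq_zero _ _ h).1⟩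

theorem sum_ne_zero {n : ℕ} (y : Fin n → Conductance R) (i : Fin n) :
    ∑ k, (y k).1 ≠ 0 := by
  intro h
  rw [← Finset.add_sum_erase _ _ (Finset.mem_univ i)] at h
  exact (y i).2 (PositiveRig.eq_zero_of_add_eq_zero _ _ h).1

/-- The conductance `y i * y j / ∑ k, y k` between the nodes `i` and `j` of the mesh that
corresponds to the star with arms `y`. -/
def mesh {n : ℕ} (y : Fin n → Conductance R) (i j : Fin n) : Conductance R :=
  ⟨(y i).1 * (y j).1 / ∑ k, (y k).1,
    div_ne_zero (mul_ne_zero (y i).2 (y j).2) (sum_ne_zero y i)⟩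

end Conductance

/-! ## Circuits -/

/-- What an edge of a circuit consists of: a bare wire, or a resistor of given conductance. -/
inductive Link (R : Type u) [Semifield R] : Type u where
  | wire : Link R
  | resistor (y : Conductance R) : Link R

/-- An (undirected) edge on the node set `V`; parallel edges and loops are possible in a
circuit.  Resistors are undirected since they are self-adjoint. -/
abbrev Edge (R : Type u) [Semifield R] (V : Type) : Type u := Sym2 V × Link R

namespace Edge

variable {R : Type u} [Semifield R] {V W : Type}

def map (f : V → W) (e : Edge R V) : Edge R W := (Sym2.map f e.1, e.2)

/-- A bare wire between `a` and `b`. -/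
def wire (a b : V) : Edge R V := (s(a, b), Link.wire)

/-- A resistor between `a` and `b`. -/
def resistor (a b : V) (y : Conductance R) : Edge R V := (s(a, b), Link.resistor y)

theorem map_map {U : Type} (g : V → W) (f : U → V) (e : Edge R U) :
    map g (map f e) = map (g ∘ f) e := by
  simp [map, Sym2.map_map]

theorem map_id' (e : Edge R V) : map id e = e := by simp [map]

theorem map_wire (f : V → W) (a b : V) : map f (wire a b : Edge R V) = wire (f a) (f b) := by
  simp [map, wire]

end Edge

/-- A string diagram with `m` inputs and `n` outputs built from junctions (spiders) and
conductances, in fully expanded form: there is a junction at both ends of every wire and of every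
resistor, and every input and every output is a leg of a junction.  The nodes are the junctions,
the edges are the bare wires and the resistors between them. -/
structure Circuit (R : Type u) [Semifield R] (m n : ℕ) where
  Node : Type
  finite_node : Finite Node
  edges : Multiset (Edge R Node)
  inp : Fin m → Node
  out : Fin n → Node

namespace Circuit

variable {R : Type u} [Semifield R] {m n k : ℕ}

/-- Isomorphism of circuits: a renaming of the nodes. -/
def Iso (C D : Circuit R m n) : Prop :=
  ∃ e : C.Node ≃ D.Node, C.edges.map (Edge.map e) = D.edges ∧
    (∀ i, e (C.inp i) = D.inp i) ∧ (∀ j, e (C.out j) = D.out j)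

theorem Iso.refl (C : Circuit R m n) : Iso C C :=
  ⟨Equiv.refl _, (Multiset.map_congr rfl fun x _ => Edge.map_id' x).trans (Multiset.map_id _),
    fun _ => rfl, fun _ => rfl⟩

theorem Iso.symm {C D : Circuit R m n} : Iso C D → Iso D C := by
  rintro ⟨e, he, hi, ho⟩
  refine ⟨e.symm, ?_, fun i => by simp [← hi], fun j => by simp [← ho]⟩
  rw [← he, Multiset.map_map]
  simp [Function.comp_def, Edge.map, Sym2.map_map]

theorem Iso.trans {C D E : Circuit R m n} : Iso C D → Iso D E → Iso C E := by
  rintro ⟨e, he, hi, ho⟩ ⟨f, hf, hi', ho'⟩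
  refine ⟨e.trans f, ?_, fun i => by simp [hi, hi'], fun j => by simp [ho, ho']⟩
  rw [← hf, ← he, Multiset.map_map]
  refine Multiset.map_congr rfl fun x _ => ?_
  simp [Edge.map, Sym2.map_map]

instance setoid (R : Type u) [Semifield R] (m n : ℕ) : Setoid (Circuit R m n) :=
  ⟨Iso, Iso.refl, Iso.symm, Iso.trans⟩

/-- The identity: `n` junctions, each with one input and one output. -/
def id (R : Type u) [Semifield R] (n : ℕ) : Circuit R n n :=
  ⟨Fin n, inferInstance, 0, fun i => i, fun i => i⟩

/-- The junction with `m` inputs and `n` outputs. -/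
def junction (R : Type u) [Semifield R] (m n : ℕ) : Circuit R m n :=
  ⟨Unit, inferInstance, 0, fun _ => (), fun _ => ()⟩

/-- A resistor, as a circuit from `1` to `1`. -/
def conductance (y : Conductance R) : Circuit R 1 1 :=
  ⟨Bool, inferInstance, {Edge.resistor false true y}, fun _ => false, fun _ => true⟩

/-- Composition in diagrammatic order: the outputs of `C` are wired to the inputs of `D`. -/
def comp (C : Circuit R m k) (D : Circuit R k n) : Circuit R m n where
  Node := C.Node ⊕ D.Node
  finite_node := by
    have := C.finite_node
    have := D.finite_node
    infer_instance
  edges := C.edges.map (Edge.map Sum.inl) + D.edges.map (Edge.map Sum.inr) +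
    (Finset.univ : Finset (Fin k)).val.map
      fun j => Edge.wire (Sum.inl (C.out j)) (Sum.inr (D.inp j))
  inp := fun i => Sum.inl (C.inp i)
  out := fun j => Sum.inr (D.out j)

/-- The tensor product: juxtaposition. -/
def tensor {m' n' : ℕ} (C : Circuit R m n) (D : Circuit R m' n') :
    Circuit R (m + m') (n + n') where
  Node := C.Node ⊕ D.Node
  finite_node := by
    have := C.finite_node
    have := D.finite_node
    infer_instance
  edges := C.edges.map (Edge.map Sum.inl) + D.edges.map (Edge.map Sum.inr)
  inp := Fin.append (fun i => Sum.inl (C.inp i)) (fun i => Sum.inr (D.inp i))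
  out := Fin.append (fun j => Sum.inl (C.out j)) (fun j => Sum.inr (D.out j))

/-- The star with one internal node `none`, and arms of conductances `y i` to the `n` nodes
`some i`, the `i`-th of which is the `i`-th output. -/
def star {n : ℕ} (y : Fin n → Conductance R) : Circuit R 0 n :=
  ⟨Option (Fin n), inferInstance,
    (Finset.univ : Finset (Fin n)).val.map fun i => Edge.resistor none (some i) (y i),
    fun i => i.elim0, fun i => some i⟩

/-- The edges of the mesh which replaces a star whose `i`-th arm has conductance `y i` and ends at
the node `a i`: one resistor for each pair of arms `i < j`. -/
def meshEdges [PositiveRig R] {V : Type} {n : ℕ} (a : Fin n → V) (y : Fin n → Conductance R) :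
    Multiset (Edge R V) :=
  ((Finset.univ : Finset (Fin n × Fin n)).filter fun p => p.1 < p.2).val.map
    fun p => Edge.resistor (a p.1) (a p.2) (Conductance.mesh y p.1 p.2)

/-- The mesh corresponding to the star with arms `y`: all `n` nodes are outputs. -/
def mesh [PositiveRig R] {n : ℕ} (y : Fin n → Conductance R) : Circuit R 0 n :=
  ⟨Fin n, inferInstance, meshEdges (fun i => i) y, fun i => i.elim0, fun i => i⟩

/-- The number of nodes. -/
noncomputable def numNodes (C : Circuit R m n) : ℕ := Nat.card C.Node

open Classical in
/-- The number of parallel edges: an edge is counted if another edge has the same ends, or if it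
is a loop (so that it is parallel to the junction itself). -/
noncomputable def numParallel (C : Circuit R m n) : ℕ :=
  (C.edges.filter fun e => e.1.IsDiag ∨ 2 ≤ (C.edges.map Prod.fst).count e.1).card

/-- A node is external if an input or an output is attached to it, and internal otherwise. -/
def IsExternal (C : Circuit R m n) (v : C.Node) : Prop :=
  (∃ i, C.inp i = v) ∨ (∃ j, C.out j = v)

/-- Families of meshes: all nodes are external (each carries one or more inputs or outputs), there
are no bare wires and no loops, and any two nodes are joined by at most one resistor. -/
def IsMeshFamily (C : Circuit R m n) : Prop :=
  (∀ v, C.IsExternal v) ∧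
  (∀ e ∈ C.edges, (∃ y, e.2 = Link.resistor y) ∧ ¬ e.1.IsDiag) ∧
  (C.edges.map Prod.fst).Nodup

/-- The spider rewrites, at any place of a circuit. -/
inductive SpiderRule : Circuit R m n → Circuit R m n → Prop where
  /-- Two different junctions `none` and `some u` which are joined by a wire are amalgamated. -/
  | fuse (V : Type) (hV : Finite V) (u : V) (rest : Multiset (Edge R (Option V)))
      (inp : Fin m → Option V) (out : Fin n → Option V) :
      SpiderRule
        ⟨Option V, inferInstance, Edge.wire none (some u) ::ₘ rest, inp, out⟩
        ⟨V, hV, rest.map (Edge.map fun v => v.getD u),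
          fun i => (inp i).getD u, fun j => (out j).getD u⟩
  /-- A wire from a junction to itself is removed. -/
  | loop (V : Type) (hV : Finite V) (u : V) (rest : Multiset (Edge R V))
      (inp : Fin m → V) (out : Fin n → V) :
      SpiderRule ⟨V, hV, Edge.wire u u ::ₘ rest, inp, out⟩ ⟨V, hV, rest, inp, out⟩

/-- The rewrites of resistors, at any place of a circuit. -/
inductive ResistorRule [PositiveRig R] : Circuit R m n → Circuit R m n → Prop where
  /-- A resistor in parallel with a wire is removed. -/
  | shortCircuit (V : Type) (hV : Finite V) (u v : V) (y : Conductance R)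
      (rest : Multiset (Edge R V)) (inp : Fin m → V) (out : Fin n → V) :
      ResistorRule
        ⟨V, hV, Edge.resistor u v y ::ₘ Edge.wire u v ::ₘ rest, inp, out⟩
        ⟨V, hV, Edge.wire u v ::ₘ rest, inp, out⟩
  /-- The same when the wire has already been absorbed in a junction: a resistor from a junction
  to itself is removed. -/
  | shortCircuitLoop (V : Type) (hV : Finite V) (u : V) (y : Conductance R)
      (rest : Multiset (Edge R V)) (inp : Fin m → V) (out : Fin n → V) :
      ResistorRule
        ⟨V, hV, Edge.resistor u u y ::ₘ rest, inp, out⟩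
        ⟨V, hV, rest, inp, out⟩
  /-- Two parallel resistors are combined. -/
  | parallel (V : Type) (hV : Finite V) (u v : V) (y z : Conductance R)
      (rest : Multiset (Edge R V)) (inp : Fin m → V) (out : Fin n → V) :
      ResistorRule
        ⟨V, hV, Edge.resistor u v y ::ₘ Edge.resistor u v z ::ₘ rest, inp, out⟩
        ⟨V, hV, Edge.resistor u v (y.add z) ::ₘ rest, inp, out⟩
  /-- The star-to-mesh rule with `k` arms, for every `k`: the internal node `none`, all of whose
  edges are resistors to other nodes `a i` (which need not be different), is eliminated. -/
  | starMesh (V : Type) (hV : Finite V) (k : ℕ) (a : Fin k → V) (y : Fin k → Conductance R)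
      (rest : Multiset (Edge R V)) (inp : Fin m → V) (out : Fin n → V) :
      ResistorRule
        ⟨Option V, inferInstance,
          (Finset.univ : Finset (Fin k)).val.map
            (fun i => Edge.resistor none (some (a i)) (y i)) + rest.map (Edge.map some),
          fun i => some (inp i), fun j => some (out j)⟩
        ⟨V, hV, meshEdges a y + rest, inp, out⟩

theorem Iso.comp {C C' : Circuit R m k} {D D' : Circuit R k n} (h : Iso C C') (h' : Iso D D') :
    Iso (C.comp D) (C'.comp D') := by
  obtain ⟨e, he, hi, ho⟩ := h
  obtain ⟨f, hf, hi', ho'⟩ := h'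
  refine ⟨Equiv.sumCongr e f, ?_, fun i => congrArg Sum.inl (hi i),
    fun j => congrArg Sum.inr (ho' j)⟩
  simp only [Circuit.comp, Multiset.map_add, Multiset.map_map, ← he, ← hf]
  congr 1
  · congr 1 <;>
    · refine Multiset.map_congr rfl fun x _ => ?_
      simp only [Function.comp_apply, Edge.map_map]
      rfl
  · refine Multiset.map_congr rfl fun x _ => ?_
    simp only [Function.comp_apply, Edge.map_wire, ← ho, ← hi']
    rfl

theorem Iso.tensor {m' n' : ℕ} {C C' : Circuit R m n} {D D' : Circuit R m' n'} (h : Iso C C')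
    (h' : Iso D D') : Iso (C.tensor D) (C'.tensor D') := by
  obtain ⟨e, he, hi, ho⟩ := h
  obtain ⟨f, hf, hi', ho'⟩ := h'
  refine ⟨Equiv.sumCongr e f, ?_, fun i => ?_, fun j => ?_⟩
  · simp only [Circuit.tensor, Multiset.map_add, Multiset.map_map, ← he, ← hf]
    congr 1 <;>
    · refine Multiset.map_congr rfl fun x _ => ?_
      simp only [Function.comp_apply, Edge.map_map]
      rfl
  · refine Fin.addCases (fun i => ?_) (fun i => ?_) i
    · simp only [Circuit.tensor, Fin.append_left]
      exact congrArg Sum.inl (hi i)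
    · simp only [Circuit.tensor, Fin.append_right]
      exact congrArg Sum.inr (hi' i)
  · refine Fin.addCases (fun j => ?_) (fun j => ?_) j
    · simp only [Circuit.tensor, Fin.append_left]
      exact congrArg Sum.inl (ho j)
    · simp only [Circuit.tensor, Fin.append_right]
      exact congrArg Sum.inr (ho' j)

theorem comp_assoc_iso {l : ℕ} (C : Circuit R m k) (D : Circuit R k l) (E : Circuit R l n) :
    Iso ((C.comp D).comp E) (C.comp (D.comp E)) := by
  refine ⟨Equiv.sumAssoc C.Node D.Node E.Node, ?_, fun i => rfl, fun j => rfl⟩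
  simp only [Circuit.comp, Multiset.map_add, Multiset.map_map, Function.comp_def, Edge.map_map,
    Edge.map_wire]
  have h : ∀ a b c d e : Multiset (Edge R (C.Node ⊕ D.Node ⊕ E.Node)),
      a + b + c + d + e = a + (b + d + e) + c := fun a b c d e => by abel
  exact h _ _ _ _ _

theorem Iso.numNodes_eq {C D : Circuit R m n} (h : Iso C D) : C.numNodes = D.numNodes := by
  obtain ⟨e, -⟩ := h
  exact Nat.card_congr e

theorem Iso.numParallel_eq {C D : Circuit R m n} (h : Iso C D) :
    C.numParallel = D.numParallel := by
  classical
  obtain ⟨e, he, -, -⟩ := h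
  unfold numParallel
  rw [← he, Multiset.filter_map, Multiset.card_map]
  congr 1
  refine Multiset.filter_congr fun x _ => ?_
  have h1 : ((C.edges.map (Edge.map e)).map Prod.fst) =
      (C.edges.map Prod.fst).map (Sym2.map e) := by
    rw [Multiset.map_map, Multiset.map_map]
    rfl
  have hinj : Function.Injective (Sym2.map e) := Sym2.map.injective e.injective
  have h2 : (Edge.map e x).1.IsDiag ↔ x.1.IsDiag := by
    obtain ⟨p, l⟩ := x
    induction p using Sym2.ind with
    | _ a b => simp [Edge.map]
  simp only [Function.comp_apply, h1, h2]
  show _ ↔ (_ ∨ 2 ≤ Multiset.count (Sym2.map e x.1) _)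
  rw [Multiset.count_map_eq_count' _ _ hinj]

end Circuit

/-! ## Diagrams: circuits up to the names of their nodes -/

/-- Circuits up to isomorphism; this is what is rewritten. -/
def Diagram (R : Type u) [Semifield R] (m n : ℕ) : Type (max 1 u) :=
  Quotient (Circuit.setoid R m n)

namespace Diagram

variable {R : Type u} [Semifield R] {m n k : ℕ}

def mk (C : Circuit R m n) : Diagram R m n := Quotient.mk _ C

def id (R : Type u) [Semifield R] (n : ℕ) : Diagram R n n := mk (Circuit.id R n)

def junction (R : Type u) [Semifield R] (m n : ℕ) : Diagram R m n := mk (Circuit.junction R m n)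

def conductance (y : Conductance R) : Diagram R 1 1 := mk (Circuit.conductance y)

def comp (c : Diagram R m k) (d : Diagram R k n) : Diagram R m n :=
  Quotient.map₂ Circuit.comp (fun _ _ h _ _ h' => Circuit.Iso.comp h h') c d

def tensor {m' n' : ℕ} (c : Diagram R m n) (d : Diagram R m' n') :
    Diagram R (m + m') (n + n') :=
  Quotient.map₂ Circuit.tensor (fun _ _ h _ _ h' => Circuit.Iso.tensor h h') c d

noncomputable def numNodes (d : Diagram R m n) : ℕ :=
  Quotient.lift Circuit.numNodes (fun _ _ h => Circuit.Iso.numNodes_eq h) d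

noncomputable def numParallel (d : Diagram R m n) : ℕ :=
  Quotient.lift Circuit.numParallel (fun _ _ h => Circuit.Iso.numParallel_eq h) d

def IsMeshFamily (d : Diagram R m n) : Prop := ∃ C : Circuit R m n, d = mk C ∧ C.IsMeshFamily

/-- One rewriting step. -/
def Step [PositiveRig R] (c d : Diagram R m n) : Prop :=
  ∃ C D : Circuit R m n, c = mk C ∧ d = mk D ∧ (C.SpiderRule D ∨ C.ResistorRule D)

theorem comp_assoc {l : ℕ} (c : Diagram R m k) (d : Diagram R k l) (e : Diagram R l n) :
    (c.comp d).comp e = c.comp (d.comp e) := by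
  induction c using Quotient.inductionOn with
  | _ C =>
    induction d using Quotient.inductionOn with
    | _ D =>
      induction e using Quotient.inductionOn with
      | _ E => exact Quotient.sound (Circuit.comp_assoc_iso C D E)

/-- Equality of the maps presented by two diagrams: the congruence for composition and tensor
product generated by the identity laws, the spider identities, and the identities for
resistors. -/
inductive Equal [PositiveRig R] : ∀ {m n : ℕ}, Diagram R m n → Diagram R m n → Prop where
  | refl {m n : ℕ} (c : Diagram R m n) : Equal c c
  | symm {m n : ℕ} {c d : Diagram R m n} : Equal c d → Equal d c
  | trans {m n : ℕ} {c d e : Diagram R m n} : Equal c d → Equal d e → Equal c e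
  | comp_congr {m k n : ℕ} {c c' : Diagram R m k} {d d' : Diagram R k n} :
      Equal c c' → Equal d d' → Equal (c.comp d) (c'.comp d')
  | tensor_congr {m n m' n' : ℕ} {c c' : Diagram R m n} {d d' : Diagram R m' n'} :
      Equal c c' → Equal d d' → Equal (c.tensor d) (c'.tensor d')
  | id_comp {m n : ℕ} (c : Diagram R m n) : Equal ((id R m).comp c) c
  | comp_id {m n : ℕ} (c : Diagram R m n) : Equal (c.comp (id R n)) c
  | spider {m n : ℕ} {C D : Circuit R m n} : C.SpiderRule D → Equal (mk C) (mk D)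
  /-- A resistor equals its transpose. -/
  | selfAdjoint (y : Conductance R) :
      Equal (m := 1) (n := 1)
        (((id R 1).tensor (junction R 0 2)).comp
          ((((id R 1).tensor (conductance y)).tensor (id R 1)).comp
            ((junction R 2 0).tensor (id R 1))))
        (conductance y)
  | shortCircuit (y : Conductance R) :
      Equal ((junction R 1 2).comp (((conductance y).tensor (id R 1)).comp (junction R 2 1)))
        (id R 1)
  | parallel (y z : Conductance R) :
      Equal ((junction R 1 2).comp (((conductance y).tensor (conductance z)).comp
        (junction R 2 1))) (conductance (y.add z))
  | starMesh {n : ℕ} (y : Fin n → Conductance R) :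
      Equal (mk (Circuit.star y)) (mk (Circuit.mesh y))

end Diagram

/-! ## The category of resistor circuits -/

/-- The objects of the category of resistor circuits: natural numbers. -/
structure Resist (R : Type u) : Type where
  arity : ℕ

namespace Resist

variable {R : Type u} [Semifield R] [PositiveRig R]

def setoid (R : Type u) [Semifield R] [PositiveRig R] (m n : ℕ) : Setoid (Diagram R m n) :=
  ⟨Diagram.Equal, Diagram.Equal.refl, Diagram.Equal.symm, Diagram.Equal.trans⟩

instance category : CategoryTheory.Category.{max 1 u} (Resist R) where
  Hom X Y := Quotient (setoid R X.arity Y.arity)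
  id X := Quotient.mk _ (Diagram.id R X.arity)
  comp f g := Quotient.map₂ Diagram.comp (fun _ _ h _ _ h' => Diagram.Equal.comp_congr h h') f g
  id_comp f := by
    induction f using Quotient.inductionOn with
    | _ c => exact Quotient.sound (Diagram.Equal.id_comp c)
  comp_id f := by
    induction f using Quotient.inductionOn with
    | _ c => exact Quotient.sound (Diagram.Equal.comp_id c)
  assoc f g h := by
    induction f using Quotient.inductionOn with
    | _ c =>
      induction g using Quotient.inductionOn with
      | _ d =>
        induction h using Quotient.inductionOn with
        | _ e => exact congrArg (Quotient.mk _) (Diagram.comp_assoc c d e)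

/-- The map presented by a diagram. -/
def ofDiagram {m n : ℕ} (d : Diagram R m n) : (Resist.mk m : Resist R) ⟶ Resist.mk n :=
  Quotient.mk (setoid R m n) d

/-- The tensor product of maps; on objects it is addition. -/
def tensorHom {X Y X' Y' : Resist R} (f : X ⟶ Y) (g : X' ⟶ Y') :
    (Resist.mk (X.arity + X'.arity) : Resist R) ⟶ Resist.mk (Y.arity + Y'.arity) :=
  Quotient.map₂ (sa := setoid R X.arity Y.arity) (sb := setoid R X'.arity Y'.arity)
    (sc := setoid R (X.arity + X'.arity) (Y.arity + Y'.arity)) Diagram.tensor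
    (fun _ _ h _ _ h' => Diagram.Equal.tensor_congr h h') f g

end Resist

/-! ## Abstract rewriting -/

namespace Rewriting

variable {α : Type u}

def Terminating (r : α → α → Prop) : Prop := WellFounded fun b a => r a b

def LocallyConfluent (r : α → α → Prop) : Prop :=
  ∀ a b c, r a b → r a c → Relation.Join (Relation.ReflTransGen r) b c

def Confluent (r : α → α → Prop) : Prop :=
  ∀ a b c, Relation.ReflTransGen r a b → Relation.ReflTransGen r a c →
    Relation.Join (Relation.ReflTransGen r) b c

def IsNormal (r : α → α → Prop) (a : α) : Prop := ∀ b, ¬ r a b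

end Rewriting

/-! Every circuit has a meaning that no step changes: contract the wires, add up parallel resistors,
and eliminate all internal classes of nodes by the star-mesh formula. What is left is an equivalence
relation on the inputs and outputs (which of them are short-circuited) together with a symmetric
weight between its classes. This is well defined because eliminations commute (`Weight.elim_comm`):
eliminating two nodes gives a Schur complement that is symmetric in them. Positivity of the rig
settles the cases in which a denominator vanishes.

A family of meshes can be recovered from its meaning, since its nodes are the classes of terminals
and its resistors are the nonzero weights (`Circuit.IsMeshFamily.iso`). A circuit that is not such a
family admits a step, and steps decrease a well-founded measure. So every circuit has exactly one
normal form, and confluence follows from this without any inspection of critical pairs.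

For the comparison with the category, one direction (`Diagram.join_of_equal`) realizes every
generating identity as a rewriting, shows that rewriting is compatible with composition and tensor
product by means of contexts, and gets transitivity from confluence. The other direction
(`Diagram.equal_of_resistorRule`) writes a circuit in which a rule applies as a composite that
contains the bare pattern of the rule, up to contraction of wires, and uses congruence.

Being connected by wires is expressed throughout by predicates: two nodes are connected when every
predicate that is constant along wires agrees on them. -/

namespace Edge

variable {R : Type u} [Semifield R] {U V W : Type}

theorem map_multiset_id (E : Multiset (Edge R V)) : E.map (map id) = E :=
  (Multiset.map_congr rfl fun x _ => map_id' x).trans (Multiset.map_id _)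

theorem map_multiset_map (f : V → W) (g : U → V) (E : Multiset (Edge R U)) :
    (E.map (map g)).map (map f) = E.map (map (f ∘ g)) := by
  rw [Multiset.map_map]
  simp only [Function.comp_def, map_map]

end Edge

namespace Diagram

variable {R : Type u} [Semifield R] {m n : ℕ}

theorem mk_eq_mk_iff {C D : Circuit R m n} : mk C = mk D ↔ C.Iso D :=
  ⟨fun h => Quotient.exact h, fun h => Quotient.sound h⟩

/-- A rewriting step by a spider rule. -/
def SpiderStep (c d : Diagram R m n) : Prop :=
  ∃ C D : Circuit R m n, c = mk C ∧ d = mk D ∧ C.SpiderRule D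

theorem SpiderStep.step [PositiveRig R] {c d : Diagram R m n} (h : SpiderStep c d) :
    Step c d := by
  obtain ⟨C, D, hC, hD, h⟩ := h
  exact ⟨C, D, hC, hD, Or.inl h⟩

theorem SpiderStep.equal [PositiveRig R] {c d : Diagram R m n} (h : SpiderStep c d) :
    Equal c d := by
  obtain ⟨C, D, rfl, rfl, h⟩ := h
  exact Equal.spider h

theorem equal_of_spider [PositiveRig R] {c d : Diagram R m n}
    (h : Relation.ReflTransGen SpiderStep c d) : Equal c d := by
  induction h with
  | refl => exact Equal.refl _
  | tail _ h ih => exact ih.trans h.equal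

theorem steps_of_spider [PositiveRig R] {c d : Diagram R m n}
    (h : Relation.ReflTransGen SpiderStep c d) : Relation.ReflTransGen Step c d :=
  Relation.ReflTransGen.mono (fun _ _ h => h.step) _ _ h

end Diagram

/-! ### Contraction of wires by spider steps. -/

namespace Circuit

variable {R : Type u} [Semifield R] {m n : ℕ}

/-- The map from `V` to `V` without `a` which sends `a` to `b`. -/
noncomputable def collapse {V : Type} (a b : V) (hab : b ≠ a) (v : V) : {v : V // v ≠ a} := by
  classical exact ((Equiv.optionSubtypeNe a).symm v).getD ⟨b, hab⟩

theorem collapse_self {V : Type} (a b : V) (hab : b ≠ a) : collapse a b hab a = ⟨b, hab⟩ := by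
  classical simp [collapse]

theorem collapse_of_ne {V : Type} (a b : V) (hab : b ≠ a) {v : V} (hv : v ≠ a) :
    collapse a b hab v = ⟨v, hv⟩ := by
  classical simp [collapse, Equiv.optionSubtypeNe_symm_of_ne hv]

/-- Renaming the nodes of a circuit. -/
theorem mk_rename {V W : Type} (hV : Finite V) (hW : Finite W) (e : V ≃ W)
    (E : Multiset (Edge R V)) (inp : Fin m → V) (out : Fin n → V) :
    Diagram.mk ⟨V, hV, E, inp, out⟩ =
      Diagram.mk ⟨W, hW, E.map (Edge.map e), e ∘ inp, e ∘ out⟩ :=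
  Diagram.mk_eq_mk_iff.2 ⟨e, rfl, fun _ => rfl, fun _ => rfl⟩

/-- The rule `fuse` is stated on `Option V`; singling out `a` by `Equiv.optionSubtypeNe` makes it
available for a wire between any two different nodes. -/
theorem spiderStep_fuse {V : Type} (hV : Finite V) (a b : V) (hab : b ≠ a)
    (E : Multiset (Edge R V)) (inp : Fin m → V) (out : Fin n → V) :
    Diagram.SpiderStep (Diagram.mk ⟨V, hV, Edge.wire a b ::ₘ E, inp, out⟩)
      (Diagram.mk ⟨{v : V // v ≠ a}, inferInstance, E.map (Edge.map (collapse a b hab)),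
        collapse a b hab ∘ inp, collapse a b hab ∘ out⟩) := by
  classical
  refine ⟨_, _, ?_, ?_, SpiderRule.fuse {v : V // v ≠ a} inferInstance ⟨b, hab⟩
    (E.map (Edge.map (Equiv.optionSubtypeNe a).symm)) ((Equiv.optionSubtypeNe a).symm ∘ inp)
    ((Equiv.optionSubtypeNe a).symm ∘ out)⟩
  · rw [mk_rename hV inferInstance (Equiv.optionSubtypeNe a).symm]
    simp [Edge.map_wire, Equiv.optionSubtypeNe_symm_of_ne hab]
  · rw [Multiset.map_map]
    simp only [Function.comp_def, Edge.map_map]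
    rfl

/-- Contraction of wires: if `f` amalgamates exactly the nodes that are connected by the wires
`W`, then the spider rules rewrite a circuit with these wires to its image along `f`. -/
theorem contract_wires : ∀ (l : ℕ) {V : Type} (hV : Finite V) (W : Multiset (V × V))
    (_ : W.card = l)
    (E : Multiset (Edge R V)) (inp : Fin m → V) (out : Fin n → V) (D : Circuit R m n)
    (f : V → D.Node) (g : D.Node → V) (_ : ∀ d, f (g d) = d)
    (_ : ∀ p ∈ W, f p.1 = f p.2)
    (_ : ∀ x, ∀ h : V → Prop, (∀ p ∈ W, h p.1 = h p.2) → h (g (f x)) = h x)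
    (_ : D.edges = E.map (Edge.map f)) (_ : ∀ i, D.inp i = f (inp i))
    (_ : ∀ j, D.out j = f (out j)),
    Relation.ReflTransGen Diagram.SpiderStep
      (Diagram.mk ⟨V, hV, W.map (fun p => Edge.wire p.1 p.2) + E, inp, out⟩) (Diagram.mk D)
  | 0, V, hV, W, hW, E, inp, out, D, f, g, hfg, hf, hg, hE, hi, ho => by
    obtain rfl := Multiset.card_eq_zero.1 hW
    -- Without wires every predicate is admissible in `hg`, so equality with `x` may be tested: `f`
    -- is a bijection.
    have hgf : ∀ x, g (f x) = x := fun x => by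
      have := hg x (fun y => y = x) (by simp)
      simpa using this
    refine Relation.ReflTransGen.refl.trans ?_
    rw [Diagram.mk_eq_mk_iff.2 (?_ : Iso _ D)]
    exact ⟨⟨f, g, hgf, hfg⟩, by simp [hE], fun i => (hi i).symm, fun j => (ho j).symm⟩
  | l + 1, V, hV, W, hW, E, inp, out, D, f, g, hfg, hf, hg, hE, hi, ho => by
    obtain ⟨p, W', rfl⟩ : ∃ p W', W = p ::ₘ W' := by
      obtain ⟨p, hp⟩ := Multiset.card_pos_iff_exists_mem.1 (by omega : 0 < W.card)
      exact ⟨p, Multiset.exists_cons_of_mem hp⟩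
    obtain ⟨a, b⟩ := p
    have hW' : W'.card = l := by simpa using hW
    rw [Multiset.map_cons, Multiset.cons_add]
    by_cases hab : b = a
    · subst hab
      refine Relation.ReflTransGen.head
        ⟨_, _, rfl, rfl, SpiderRule.loop V hV b _ inp out⟩ ?_
      refine contract_wires l hV W' hW' E inp out D f g hfg (fun p hp => hf p (by simp [hp]))
        (fun x h hh => hg x h ?_) hE hi ho
      intro p hp
      rcases Multiset.mem_cons.1 hp with rfl | hp
      · rfl
      · exact hh p hp
    · refine Relation.ReflTransGen.head (spiderStep_fuse hV a b hab _ inp out) ?_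
      have hfab : f a = f b := hf (a, b) (by simp)
      have hc : ∀ v, f (collapse a b hab v).1 = f v := fun v => by
        by_cases hv : v = a
        · subst hv
          rw [collapse_self]
          exact hfab.symm
        · rw [collapse_of_ne a b hab hv]
      have key := contract_wires l (V := {v : V // v ≠ a}) inferInstance
        (W'.map fun p => (collapse a b hab p.1, collapse a b hab p.2)) (by simpa using hW')
        (E.map (Edge.map (collapse a b hab))) (collapse a b hab ∘ inp) (collapse a b hab ∘ out) D
        (fun v => f v.1) (fun d => collapse a b hab (g d)) (fun d => by rw [hc, hfg])
        (by
          intro p hp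
          obtain ⟨q, hq, rfl⟩ := Multiset.mem_map.1 hp
          simpa only [hc] using hf q (by simp [hq]))
        (by
          intro x h hh
          -- A predicate on the remaining nodes is pulled back along `collapse`; it is then constant
          -- along the fused wire as well.
          have := hg x.1 (h ∘ collapse a b hab) (by
            intro p hp
            rcases Multiset.mem_cons.1 hp with rfl | hp
            · simp only [Function.comp_apply]
              rw [collapse_self, collapse_of_ne a b hab hab]
            · exact hh _ (Multiset.mem_map_of_mem _ hp))
          simp only [Function.comp_apply] at this
          rw [this, collapse_of_ne a b hab x.2])
        (by
          rw [hE, Multiset.map_map]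
          simp only [Function.comp_def, Edge.map_map, hc])
        (fun i => by rw [hi, Function.comp_apply, hc]) (fun j => by rw [ho, Function.comp_apply, hc])
      convert key using 4
      rw [Multiset.map_add, Multiset.map_map, Multiset.map_map]
      simp only [Function.comp_def, Edge.map_wire]

/-- The contraction of wires, for a circuit whose edges are given as a sum. -/
theorem spiders_of_contraction (C D : Circuit R m n) (W : Multiset (C.Node × C.Node))
    (E : Multiset (Edge R C.Node)) (hC : C.edges = W.map (fun p => Edge.wire p.1 p.2) + E)
    (f : C.Node → D.Node) (g : D.Node → C.Node) (hfg : ∀ d, f (g d) = d)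
    (hf : ∀ p ∈ W, f p.1 = f p.2)
    (hg : ∀ x, ∀ h : C.Node → Prop, (∀ p ∈ W, h p.1 = h p.2) → h (g (f x)) = h x)
    (hE : D.edges = E.map (Edge.map f)) (hi : ∀ i, D.inp i = f (C.inp i))
    (ho : ∀ j, D.out j = f (C.out j)) :
    Relation.ReflTransGen Diagram.SpiderStep (Diagram.mk C) (Diagram.mk D) := by
  have h := contract_wires _ C.finite_node W rfl E C.inp C.out D f g hfg hf hg hE hi ho
  rw [← hC] at h
  exact h

end Circuit

/-! ## Weighted graphs and the elimination of nodes -/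

namespace PositiveRig

variable {R : Type u} [Semifield R] [PositiveRig R]

theorem sum_eq_zero {ι : Type*} (s : Finset ι) (f : ι → R) (h : ∑ i ∈ s, f i = 0) :
    ∀ i ∈ s, f i = 0 := by
  classical
  intro i hi
  rw [← Finset.add_sum_erase _ _ hi] at h
  exact (eq_zero_of_add_eq_zero _ _ h).1

/-- The algebraic identity behind the exchange of two eliminations. -/
theorem eliminate_exchange (w m A B ax xb ay yb : R) (hax : A = 0 → ax = 0) (hxb : A = 0 → xb = 0)
    (hay : B = 0 → ay = 0) (hyb : B = 0 → yb = 0) :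
    w + ax * xb / (m + A) +
        (ay + ax * m / (m + A)) * (yb + m * xb / (m + A)) / (B + m * A / (m + A)) =
      w + ay * yb / (m + B) +
        (ax + ay * m / (m + B)) * (xb + m * yb / (m + B)) / (A + m * B / (m + B)) := by
  -- In the degenerate cases positivity makes the weights involved vanish, and the convention `x / 0
  -- = 0` gives both sides the same value.
  by_cases hA : m + A = 0
  · obtain ⟨rfl, rfl⟩ := eq_zero_of_add_eq_zero _ _ hA
    simp [hax rfl, hxb rfl]
  by_cases hB : m + B = 0
  · obtain ⟨rfl, rfl⟩ := eq_zero_of_add_eq_zero _ _ hB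
    simp [hay rfl, hyb rfl]
  -- This is the determinant `(m + A) * (m + B) - m ^ 2` of the block of the two nodes, written
  -- without subtraction. If it vanishes, the two nodes are joined only to each other.
  by_cases hD : A * B + m * A + m * B = 0
  · obtain ⟨h1, hmB⟩ := eq_zero_of_add_eq_zero _ _ hD
    obtain ⟨hAB, hmA⟩ := eq_zero_of_add_eq_zero _ _ h1
    have hm : m ≠ 0 := by
      rintro rfl
      rcases mul_eq_zero.1 hAB with rfl | rfl
      · simp at hA
      · simp at hB
    have hA0 : A = 0 := (mul_eq_zero.1 hmA).resolve_left hm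
    have hB0 : B = 0 := (mul_eq_zero.1 hmB).resolve_left hm
    simp [hax hA0, hay hB0]
  have e1 : B + m * A / (m + A) = (A * B + m * A + m * B) / (m + A) := by
    field_simp
    ring
  have e2 : A + m * B / (m + B) = (A * B + m * A + m * B) / (m + B) := by
    field_simp
    ring
  have hD' : A * (B + m) + m * B ≠ 0 := by
    convert hD using 1
    ring
  rw [e1, e2]
  field_simp
  ring

end PositiveRig

/-- A weighted graph: symmetric weights without loops. -/
@[ext] structure Weight (R : Type u) [Semifield R] (Q : Type) where
  val : Q → Q → R
  symm : ∀ a b, val a b = val b a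
  diag : ∀ a, val a a = 0

namespace Weight

variable {R : Type u} [Semifield R] {Q Q' : Type} [Fintype Q] [Fintype Q']

open Classical in
/-- Elimination of the node `x`, which becomes isolated. -/
noncomputable def elim (x : Q) (w : Weight R Q) : Weight R Q where
  val a b := if a = x ∨ b = x ∨ a = b then 0
    else w.val a b + w.val a x * w.val x b / ∑ c, w.val x c
  symm a b := by
    by_cases h1 : a = x <;> by_cases h2 : b = x <;> by_cases h3 : a = b <;>
      simp [h1, h2, h3, eq_comm]
    rw [w.symm a b, w.symm a x, w.symm x b,
      mul_comm]
  diag a := by simp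

theorem elim_val_of_ne (x : Q) (w : Weight R Q) {a b : Q} (ha : a ≠ x) (hb : b ≠ x)
    (hab : a ≠ b) :
    (w.elim x).val a b = w.val a b + w.val a x * w.val x b / ∑ c, w.val x c := by
  simp [elim, ha, hb, hab]

theorem elim_val_left (x : Q) (w : Weight R Q) (b : Q) : (w.elim x).val x b = 0 := by
  simp [elim]

theorem elim_val_right (x : Q) (w : Weight R Q) (a : Q) : (w.elim x).val a x = 0 := by
  simp [elim]

/-- With `m` the weight between `x` and `y`, and `A`, `B` their total weights to the other nodes,
eliminating `x` changes the total weight at `y` to `B + m * A / (m + A)`. After unfolding, the claim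
is `PositiveRig.eliminate_exchange`; its side conditions hold because `a` and `b` are among the
nodes summed over in `A` and `B`. -/
theorem elim_elim_val [PositiveRig R] (w : Weight R Q) {x y a b : Q} (hxy : x ≠ y)
    (hax : a ≠ x) (hay : a ≠ y) (hbx : b ≠ x) (hby : b ≠ y) (hab : a ≠ b) :
    ((w.elim x).elim y).val a b = ((w.elim y).elim x).val a b := by
  classical
  set s : Finset Q := (Finset.univ.erase x).erase y with hs
  have hsum : ∀ f : Q → R, ∑ c, f c = f x + (f y + ∑ c ∈ s, f c) := fun f => by
    rw [hs, Finset.add_sum_erase _ f (by simp [hxy.symm]), Finset.add_sum_erase _ f (by simp)]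
  have hmem : ∀ c ∈ s, c ≠ x ∧ c ≠ y := fun c hc => by
    simp only [hs, Finset.mem_erase] at hc
    exact ⟨hc.2.1, hc.1⟩
  have has : a ∈ s := by simp [hs, hax, hay]
  have hbs : b ∈ s := by simp [hs, hbx, hby]
  have hSx : ∑ c, w.val x c = w.val x y + ∑ c ∈ s, w.val x c := by
    rw [hsum, w.diag, zero_add]
  have hSy : ∑ c, w.val y c = w.val x y + ∑ c ∈ s, w.val y c := by
    rw [hsum, w.diag, zero_add, w.symm y x]
  have hTy : ∑ c, (w.elim x).val y c = ∑ c ∈ s, w.val y c +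
      w.val x y * (∑ c ∈ s, w.val x c) / (w.val x y + ∑ c ∈ s, w.val x c) := by
    rw [hsum, elim_val_right, diag, zero_add, zero_add, Finset.mul_sum, Finset.sum_div,
      ← Finset.sum_add_distrib]
    refine Finset.sum_congr rfl fun c hc => ?_
    rw [elim_val_of_ne _ _ hxy.symm (hmem c hc).1 (hmem c hc).2.symm, hSx, w.symm y x]
  have hTx : ∑ c, (w.elim y).val x c = ∑ c ∈ s, w.val x c +
      w.val x y * (∑ c ∈ s, w.val y c) / (w.val x y + ∑ c ∈ s, w.val y c) := by
    rw [hsum, elim_val_right, diag, zero_add, zero_add, Finset.mul_sum, Finset.sum_div,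
      ← Finset.sum_add_distrib]
    refine Finset.sum_congr rfl fun c hc => ?_
    rw [elim_val_of_ne _ _ hxy (hmem c hc).2 (hmem c hc).1.symm, hSy]
  rw [elim_val_of_ne _ _ hay hby hab, elim_val_of_ne _ _ hax hbx hab, hTy,
    elim_val_of_ne _ _ hax hbx hab, hTx, elim_val_of_ne _ _ hax hxy.symm hay,
    elim_val_of_ne _ _ hxy.symm hbx hby.symm, elim_val_of_ne _ _ hay hby hab,
    elim_val_of_ne _ _ hay hxy hax, elim_val_of_ne _ _ hxy hby hbx.symm, hSx, hSy, w.symm y x]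
  apply PositiveRig.eliminate_exchange
  · intro h
    rw [w.symm]
    exact PositiveRig.sum_eq_zero _ _ h a has
  · intro h
    exact PositiveRig.sum_eq_zero _ _ h b hbs
  · intro h
    rw [w.symm]
    exact PositiveRig.sum_eq_zero _ _ h a has
  · intro h
    exact PositiveRig.sum_eq_zero _ _ h b hbs

theorem elim_val_eq_zero (x y : Q) (w : Weight R Q) {a b : Q}
    (h : a = x ∨ b = x ∨ a = y ∨ b = y ∨ a = b) : ((w.elim x).elim y).val a b = 0 := by
  by_cases ha : a = y
  · rw [ha, elim_val_left]
  by_cases hb : b = y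
  · rw [hb, elim_val_right]
  by_cases hab : a = b
  · rw [hab, diag]
  rw [elim_val_of_ne _ _ ha hb hab]
  have h : a = x ∨ b = x := by tauto
  rcases h with rfl | rfl
  · simp [elim_val_left]
  · simp [elim_val_right]

theorem elim_comm [PositiveRig R] (x y : Q) (w : Weight R Q) :
    (w.elim x).elim y = (w.elim y).elim x := by
  rcases eq_or_ne x y with rfl | hxy
  · rfl
  ext a b
  by_cases h : a = x ∨ b = x ∨ a = y ∨ b = y ∨ a = b
  · rw [elim_val_eq_zero x y w h, elim_val_eq_zero y x w (by tauto)]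
  · simp only [not_or] at h
    exact elim_elim_val w hxy h.1 h.2.2.1 h.2.1 h.2.2.2.1 h.2.2.2.2

/-- This makes a fold of eliminations over an unordered set meaningful. -/
instance [PositiveRig R] : LeftCommutative (elim : Q → Weight R Q → Weight R Q) :=
  ⟨fun x y w => elim_comm y x w⟩

/-- Elimination of all nodes of a finite set, in any order. -/
noncomputable def elimAll [PositiveRig R] (s : Finset Q) (w : Weight R Q) : Weight R Q :=
  s.val.foldr elim w

@[simp] theorem elimAll_empty [PositiveRig R] (w : Weight R Q) : w.elimAll ∅ = w := rfl

theorem elimAll_insert [PositiveRig R] [DecidableEq Q] {x : Q} {s : Finset Q} (hx : x ∉ s)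
    (w : Weight R Q) : w.elimAll (insert x s) = (w.elimAll s).elim x := by
  simp [elimAll, Finset.insert_val_of_notMem hx]

theorem elimAll_elim [PositiveRig R] (x : Q) (s : Finset Q) (w : Weight R Q) :
    (w.elim x).elimAll s = (w.elimAll s).elim x := by
  classical
  induction s using Finset.induction_on with
  | empty => rfl
  | insert y s hy ih => rw [elimAll_insert hy, elimAll_insert hy, ih, elim_comm]

/-- `w'` is the image of `w` along the inclusion `f`, with isolated nodes outside. -/
structure Extends (f : Q → Q') (w : Weight R Q) (w' : Weight R Q') : Prop where
  val_map : ∀ a b, w'.val (f a) (f b) = w.val a b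
  isolated : ∀ a z, (∀ b, f b ≠ z) → w'.val (f a) z = 0

theorem Extends.elim {f : Q → Q'} (hf : Function.Injective f) {w : Weight R Q} {w' : Weight R Q'}
    (h : Extends f w w') (x : Q) : Extends f (w.elim x) (w'.elim (f x)) := by
  classical
  -- Nodes outside the image of `f` are isolated from it, so the denominator in the elimination is
  -- unchanged.
  have hsum : ∑ z, w'.val (f x) z = ∑ c, w.val x c := by
    rw [← Finset.sum_subset (Finset.subset_univ (Finset.univ.image f)),
      Finset.sum_image fun a _ b _ hab => hf hab]
    · exact Finset.sum_congr rfl fun c _ => h.val_map x c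
    · intro z _ hz
      refine h.isolated x z fun b hb => hz ?_
      rw [← hb]
      exact Finset.mem_image_of_mem _ (Finset.mem_univ b)
  constructor
  · intro a b
    simp only [Weight.elim, hf.eq_iff, h.val_map, hsum]
  · intro a z hz
    simp only [Weight.elim, h.isolated _ z hz]
    simp

theorem Extends.elimAll [PositiveRig R] {f : Q → Q'} (hf : Function.Injective f)
    {w : Weight R Q} {w' : Weight R Q'} (h : Extends f w w') (s : Finset Q) :
    Extends f (w.elimAll s) (w'.elimAll (s.map ⟨f, hf⟩)) := by
  classical
  induction s using Finset.induction_on with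
  | empty => exact h
  | insert x s hx ih =>
    rw [elimAll_insert hx, Finset.map_insert, elimAll_insert (by simpa [hf.eq_iff] using hx)]
    exact ih.elim hf x

end Weight

/-! ## The meaning of a circuit

The wires are contracted, parallel resistors are added up, and all internal nodes are eliminated.
What remains is an equivalence relation and a weight on the set of inputs and outputs. -/

namespace Link

variable {R : Type u} [Semifield R]

/-- The conductance of a resistor; wires are not counted. -/
def value : Link R → R
  | wire => 0
  | resistor y => y.1

end Link

open Classical in
/-- The contribution of an edge to the weight between `p` and `q`. -/
noncomputable def Edge.weight {R : Type u} [Semifield R] {Q : Type} (e : Edge R Q) (p q : Q) : R :=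
  if p ≠ q ∧ e.1 = s(p, q) then e.2.value else 0

namespace Edge

variable {R : Type u} [Semifield R] {Q : Type}

theorem weight_of_eq {e : Edge R Q} {p q : Q} (h : p ≠ q) (h' : e.1 = s(p, q)) :
    e.weight p q = e.2.value := if_pos ⟨h, h'⟩

theorem weight_of_ne {e : Edge R Q} {p q : Q} (h : p ≠ q → e.1 ≠ s(p, q)) :
    e.weight p q = 0 := if_neg fun h' => h h'.1 h'.2

theorem weight_congr {Q' : Type} {e : Edge R Q} {e' : Edge R Q'} {p q : Q} {p' q' : Q'}
    (h : p ≠ q ∧ e.1 = s(p, q) ↔ p' ≠ q' ∧ e'.1 = s(p', q')) (hv : e.2 = e'.2) :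
    e.weight p q = e'.weight p' q' := by
  by_cases hp : p ≠ q ∧ e.1 = s(p, q)
  · rw [weight_of_eq hp.1 hp.2, weight_of_eq (h.1 hp).1 (h.1 hp).2, hv]
  · rw [weight_of_ne fun h1 h2 => hp ⟨h1, h2⟩, weight_of_ne fun h1 h2 => hp (h.2 ⟨h1, h2⟩)]

theorem weight_wire (a b p q : Q) : (wire a b : Edge R Q).weight p q = 0 := by
  by_cases h : p ≠ q ∧ s(a, b) = s(p, q)
  · exact weight_of_eq h.1 h.2
  · exact weight_of_ne fun h1 h2 => h ⟨h1, h2⟩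

theorem weight_resistor_self (a p q : Q) (y : Conductance R) :
    (resistor a a y).weight p q = 0 := by
  refine weight_of_ne fun h h' => h ?_
  rcases Sym2.eq_iff.1 h' with ⟨h1, h2⟩ | ⟨h1, h2⟩ <;> rw [← h1, ← h2]

theorem weight_resistor_add [PositiveRig R] (a b p q : Q) (y z : Conductance R) :
    (resistor a b (y.add z)).weight p q =
      (resistor a b y).weight p q + (resistor a b z).weight p q := by
  by_cases h : p ≠ q ∧ s(a, b) = s(p, q)
  · rw [weight_of_eq h.1 h.2, weight_of_eq h.1 h.2, weight_of_eq h.1 h.2]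
    rfl
  · rw [weight_of_ne fun h1 h2 => h ⟨h1, h2⟩, weight_of_ne fun h1 h2 => h ⟨h1, h2⟩,
      weight_of_ne fun h1 h2 => h ⟨h1, h2⟩, add_zero]

theorem map_resistor {W : Type} (f : Q → W) (a b : Q) (y : Conductance R) :
    map f (resistor a b y) = resistor (f a) (f b) y := by
  simp [map, resistor]

end Edge

namespace Weight

variable {R : Type u} [Semifield R] {Q : Type}

/-- The sums of the conductances of parallel resistors. -/
noncomputable def ofEdges (E : Multiset (Edge R Q)) : Weight R Q where
  val p q := (E.map fun e => e.weight p q).sum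
  symm p q := by
    congr 1
    refine Multiset.map_congr rfl fun e _ => Edge.weight_congr ?_ rfl
    rw [ne_comm, Sym2.eq_swap]
  diag p := by
    refine Multiset.sum_eq_zero fun x hx => ?_
    obtain ⟨e, -, rfl⟩ := Multiset.mem_map.1 hx
    exact Edge.weight_of_ne fun h => absurd rfl h

@[simp] theorem ofEdges_cons (e : Edge R Q) (E : Multiset (Edge R Q)) (p q : Q) :
    (ofEdges (e ::ₘ E)).val p q = e.weight p q + (ofEdges E).val p q := by
  simp [ofEdges]

@[simp] theorem ofEdges_add (E E' : Multiset (Edge R Q)) (p q : Q) :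
    (ofEdges (E + E')).val p q = (ofEdges E).val p q + (ofEdges E').val p q := by
  simp [ofEdges]

theorem ofEdges_map {W : Type} (f : W → Q) (hf : Function.Injective f)
    (E : Multiset (Edge R W)) (p q : W) :
    (ofEdges (E.map (Edge.map f))).val (f p) (f q) = (ofEdges E).val p q := by
  simp only [ofEdges, Multiset.map_map]
  congr 1
  refine Multiset.map_congr rfl fun e _ => ?_
  have h : Sym2.map f e.1 = s(f p, f q) ↔ e.1 = s(p, q) := by
    rw [← Sym2.map_mk, (Sym2.map.injective hf).eq_iff]
  refine Edge.weight_congr ?_ rfl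
  rw [hf.ne_iff, ← h]
  rfl

theorem ofEdges_map_of_notMem {W : Type} (f : W → Q) (E : Multiset (Edge R W)) (p q : Q)
    (hp : ∀ v, f v ≠ p) : (ofEdges (E.map (Edge.map f))).val p q = 0 := by
  simp only [ofEdges, Multiset.map_map]
  refine Multiset.sum_eq_zero fun x hx => ?_
  obtain ⟨e, -, rfl⟩ := Multiset.mem_map.1 hx
  refine Edge.weight_of_ne fun _ h => ?_
  have hmem : p ∈ (Edge.map f e).1 := by rw [h]; simp
  obtain ⟨v, -, hv⟩ := Sym2.mem_map.1 hmem
  exact hp v hv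

end Weight

namespace Circuit

variable {R : Type u} [Semifield R] {m n : ℕ}

/-- The node of an input or output. -/
def terminal (C : Circuit R m n) : Fin m ⊕ Fin n → C.Node := Sum.elim C.inp C.out

theorem isExternal_iff (C : Circuit R m n) (v : C.Node) :
    C.IsExternal v ↔ ∃ t, C.terminal t = v := by
  simp [IsExternal, terminal]

/-- `π` is the quotient of the nodes by the equivalence relation generated by the wires. -/
structure IsQuotient (C : Circuit R m n) {Q : Type} (π : C.Node → Q) : Prop where
  surjective : Function.Surjective π
  glue : ∀ x y, Edge.wire x y ∈ C.edges → π x = π y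
  separate : ∀ x y, π x = π y → ∀ h : C.Node → Prop,
    (∀ a b, Edge.wire a b ∈ C.edges → h a = h b) → h x = h y

open Classical in
/-- The classes of nodes without an input or an output. -/
noncomputable def internals (C : Circuit R m n) {Q : Type} [Fintype Q] (π : C.Node → Q) :
    Finset Q :=
  Finset.univ.filter fun q => ∀ t, π (C.terminal t) ≠ q

theorem mem_internals (C : Circuit R m n) {Q : Type} [Fintype Q] (π : C.Node → Q) (q : Q) :
    q ∈ C.internals π ↔ ∀ t, π (C.terminal t) ≠ q := by
  simp [internals]

/-- The weight between the terminals after contraction and elimination, computed on the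
quotient `π`. -/
noncomputable def response [PositiveRig R] (C : Circuit R m n) {Q : Type} [Fintype Q]
    (π : C.Node → Q) (i j : Fin m ⊕ Fin n) : R :=
  ((Weight.ofEdges (C.edges.map (Edge.map π))).elimAll (C.internals π)).val
    (π (C.terminal i)) (π (C.terminal j))

/-- The circuit `C` connects the terminals according to `r`, and has response `F`. -/
def Meaning [PositiveRig R] (C : Circuit R m n) (r : Fin m ⊕ Fin n → Fin m ⊕ Fin n → Prop)
    (F : Fin m ⊕ Fin n → Fin m ⊕ Fin n → R) : Prop :=
  ∃ (Q : Type) (_ : Fintype Q) (π : C.Node → Q), C.IsQuotient π ∧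
    (∀ i j, r i j ↔ π (C.terminal i) = π (C.terminal j)) ∧ ∀ i j, F i j = C.response π i j

theorem wire_eq_wire_iff {V : Type} {x y a b : V} :
    (Edge.wire x y : Edge R V) = Edge.wire a b ↔ (x = a ∧ y = b) ∨ (x = b ∧ y = a) := by
  simp [Edge.wire]

/-- Passes from the pairs `i < j` that index the resistors of a mesh to all ordered pairs, over
which a product of sums expands. -/
theorem sum_lt_add_swap {k : ℕ} (g : Fin k → Fin k → R) (hg : ∀ i, g i i = 0) :
    ∑ p : Fin k × Fin k with p.1 < p.2, (g p.1 p.2 + g p.2 p.1) = ∑ i, ∑ j, g i j := by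
  rw [Finset.sum_filter, Fintype.sum_prod_type]
  have h1 : ∀ i j, (if i < j then g i j + g j i else 0) =
      (if i < j then g i j else 0) + if i < j then g j i else 0 := fun i j => by
    split_ifs <;> simp
  have h2 : ∀ i j, g i j = (if i < j then g i j else 0) + if j < i then g i j else 0 := by
    intro i j
    rcases lt_trichotomy i j with h | rfl | h
    · simp [h, h.not_gt]
    · simp [hg]
    · simp [h, h.not_gt]
  simp only [h1, Finset.sum_add_distrib]
  rw [Finset.sum_comm (f := fun i j => if i < j then g j i else 0), ← Finset.sum_add_distrib]
  refine Finset.sum_congr rfl fun i _ => ?_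
  rw [← Finset.sum_add_distrib]
  exact Finset.sum_congr rfl fun j _ => (h2 i j).symm

open Classical in
theorem weight_armEdges {Q : Type} {k : ℕ} (a : Fin k → Q) (y : Fin k → Conductance R) (q : Q) :
    (Weight.ofEdges ((Finset.univ : Finset (Fin k)).val.map
      fun i => Edge.resistor none (some (a i)) (y i))).val none (some q) =
      ∑ i, if a i = q then (y i).1 else 0 := by
  simp only [Weight.ofEdges, Multiset.map_map]
  refine Finset.sum_congr rfl fun i _ => ?_
  simp only [Function.comp_apply]
  split_ifs with h
  · exact Edge.weight_of_eq (by simp) (by simp [Edge.resistor, h])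
  · exact Edge.weight_of_ne fun _ => by simp [Edge.resistor, h]

theorem weight_armEdges_some {Q : Type} {k : ℕ} (a : Fin k → Q) (y : Fin k → Conductance R)
    (p q : Q) : (Weight.ofEdges ((Finset.univ : Finset (Fin k)).val.map
      fun i => Edge.resistor none (some (a i)) (y i))).val (some p) (some q) = 0 := by
  simp only [Weight.ofEdges, Multiset.map_map]
  refine Finset.sum_eq_zero fun i _ => ?_
  exact Edge.weight_of_ne fun _ => by simp [Edge.resistor]

variable [PositiveRig R]

/-- The response does not depend on the names of the classes. -/
theorem response_comp (C : Circuit R m n) {Q Q' : Type} [Fintype Q] [Fintype Q'] (π : C.Node → Q)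
    (e : Q ≃ Q') : C.response (e ∘ π) = C.response π := by
  classical
  funext i j
  have hext : Weight.Extends e (Weight.ofEdges (C.edges.map (Edge.map π)))
      (Weight.ofEdges (C.edges.map (Edge.map (e ∘ π)))) := by
    have hE : C.edges.map (Edge.map (e ∘ π)) = (C.edges.map (Edge.map π)).map (Edge.map e) := by
      rw [Multiset.map_map]
      simp only [Function.comp_def, Edge.map_map]
    constructor
    · intro a b
      rw [hE, Weight.ofEdges_map e e.injective]
    · intro a z hz
      exact absurd (e.apply_symm_apply z) (hz _)
  have hinternal : C.internals (e ∘ π) = (C.internals π).map ⟨e, e.injective⟩ := by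
    ext q
    obtain ⟨q, rfl⟩ := e.surjective q
    simp [internals]
  have := (hext.elimAll e.injective (C.internals π)).val_map (π (C.terminal i)) (π (C.terminal j))
  unfold response
  rw [← this, hinternal]
  rfl

/-- Any two quotients by the wires have the same kernel, hence differ by a bijection of their
targets, which `response_comp` absorbs. -/
theorem Meaning.unique {C : Circuit R m n} {r r' : Fin m ⊕ Fin n → Fin m ⊕ Fin n → Prop}
    {F F' : Fin m ⊕ Fin n → Fin m ⊕ Fin n → R} (h : C.Meaning r F) (h' : C.Meaning r' F') :
    r = r' ∧ F = F' := by
  obtain ⟨Q, _, π, hπ, hr, hF⟩ := h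
  obtain ⟨Q', _, π', hπ', hr', hF'⟩ := h'
  have hker : ∀ x y, π x = π y ↔ π' x = π' y := fun x y => by
    constructor
    · intro h
      -- Having the same image as `x` under the other quotient is a predicate that is constant along
      -- wires.
      have := hπ.separate x y h (fun z => π' x = π' z) fun a b hab => by rw [hπ'.glue a b hab]
      simpa using this
    · intro h
      have := hπ'.separate x y h (fun z => π x = π z) fun a b hab => by rw [hπ.glue a b hab]
      simpa using this
  let f : Q → Q' := fun q => π' (Function.surjInv hπ.surjective q)
  have hf : ∀ x, f (π x) = π' x := fun x =>
    (hker _ _).1 (Function.surjInv_eq hπ.surjective (π x))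
  have hbij : Function.Bijective f := by
    constructor
    · intro p q hpq
      obtain ⟨x, rfl⟩ := hπ.surjective p
      obtain ⟨y, rfl⟩ := hπ.surjective q
      rw [hf, hf] at hpq
      exact (hker x y).2 hpq
    · intro q
      obtain ⟨x, rfl⟩ := hπ'.surjective q
      exact ⟨π x, hf x⟩
  have hcomp : π' = Equiv.ofBijective f hbij ∘ π := funext fun x => (hf x).symm
  constructor
  · funext i j
    rw [eq_iff_iff, hr, hr', hker]
  · funext i j
    rw [hF, hF', hcomp, response_comp]

/-! ### Invariance of the meaning under renaming and rewriting. -/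

theorem Iso.meaning {C D : Circuit R m n} (h : C.Iso D)
    {r : Fin m ⊕ Fin n → Fin m ⊕ Fin n → Prop} {F : Fin m ⊕ Fin n → Fin m ⊕ Fin n → R}
    (hD : D.Meaning r F) : C.Meaning r F := by
  classical
  obtain ⟨e, he, hi, ho⟩ := h
  obtain ⟨Q, _, π, hπ, hr, hF⟩ := hD
  have ht : ∀ t, e (C.terminal t) = D.terminal t := by
    rintro (i | j)
    · exact hi i
    · exact ho j
  refine ⟨Q, inferInstance, π ∘ e, ⟨hπ.surjective.comp e.surjective, ?_, ?_⟩, ?_, ?_⟩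
  · intro x y hxy
    refine hπ.glue _ _ ?_
    rw [← he, ← Edge.map_wire]
    exact Multiset.mem_map_of_mem _ hxy
  · intro x y hxy h hh
    have := hπ.separate _ _ hxy (h ∘ e.symm) (by
      intro a b hab
      rw [← he] at hab
      obtain ⟨a, rfl⟩ := e.surjective a
      obtain ⟨b, rfl⟩ := e.surjective b
      rw [← Edge.map_wire, Multiset.mem_map_of_injective] at hab
      · simpa using hh a b hab
      · intro p q hpq
        have := congrArg (Edge.map e.symm) hpq
        simpa [Edge.map_map, Edge.map_id'] using this)
    simpa using this
  · intro i j
    simp [hr, ht]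
  · intro i j
    have hinternal : C.internals (π ∘ e) = D.internals π := by
      simp [internals, ht]
    have hE : C.edges.map (Edge.map (π ∘ e)) = D.edges.map (Edge.map π) := by
      rw [← he, Multiset.map_map]
      simp only [Function.comp_def, Edge.map_map]
    rw [hF]
    simp [response, ht, hinternal, hE]

/-- Circuits with the same wires, and whose resistors add up to the same weights when the wires
are contracted, have the same meaning. -/
theorem Meaning.of_edges {V : Type} {hV : Finite V} {E E' : Multiset (Edge R V)}
    {inp : Fin m → V} {out : Fin n → V} {r : Fin m ⊕ Fin n → Fin m ⊕ Fin n → Prop}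
    {F : Fin m ⊕ Fin n → Fin m ⊕ Fin n → R}
    (hD : Meaning ⟨V, hV, E', inp, out⟩ r F)
    (hE : ∀ {Q : Type} (π : V → Q), (∀ x y, Edge.wire x y ∈ E' → π x = π y) →
      (∀ x y, Edge.wire x y ∈ E → π x = π y) ∧
      ∀ p q, (Weight.ofEdges (E.map (Edge.map π))).val p q =
        (Weight.ofEdges (E'.map (Edge.map π))).val p q)
    (hsub : ∀ x y, Edge.wire x y ∈ E' → Edge.wire x y ∈ E) :
    Meaning ⟨V, hV, E, inp, out⟩ r F := by
  obtain ⟨Q, _, π, hπ, hr, hF⟩ := hD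
  have h := hE π hπ.glue
  refine ⟨Q, inferInstance, π, ⟨hπ.surjective, h.1, ?_⟩, hr, ?_⟩
  · intro x y hxy h hh
    exact hπ.separate x y hxy h fun a b hab => hh a b (hsub a b hab)
  · intro i j
    rw [hF]
    have hw : Weight.ofEdges (E.map (Edge.map π)) = Weight.ofEdges (E'.map (Edge.map π)) :=
      Weight.ext (funext fun p => funext fun q => h.2 p q)
    simp only [response, hw]
    rfl

/-- Meanings are transported backwards along a step, because a quotient of the nodes of `D` can be
pulled back to the nodes of `C`. A fused wire becomes a loop, of weight zero. -/
theorem SpiderRule.meaning {C D : Circuit R m n} (h : C.SpiderRule D)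
    {r : Fin m ⊕ Fin n → Fin m ⊕ Fin n → Prop} {F : Fin m ⊕ Fin n → Fin m ⊕ Fin n → R}
    (hD : D.Meaning r F) : C.Meaning r F := by
  cases h with
  | fuse V hV u rest inp out =>
    obtain ⟨Q, _, π, hπ, hr, hF⟩ := hD
    let c : Option V → V := fun v => v.getD u
    have ht : ∀ t, c (Sum.elim inp out t) =
        Sum.elim (fun i => (inp i).getD u) (fun j => (out j).getD u) t := by
      rintro (i | j) <;> rfl
    refine ⟨Q, inferInstance, π ∘ c, ⟨hπ.surjective.comp fun v => ⟨some v, rfl⟩, ?_, ?_⟩, ?_, ?_⟩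
    · intro x y hxy
      rcases Multiset.mem_cons.1 hxy with hxy | hxy
      · rcases wire_eq_wire_iff.1 hxy with ⟨rfl, rfl⟩ | ⟨rfl, rfl⟩ <;> rfl
      · refine hπ.glue _ _ ?_
        rw [← Edge.map_wire]
        exact Multiset.mem_map_of_mem _ hxy
    · intro x y hxy h hh
      have hu : h none = h (some u) := hh _ _ (Multiset.mem_cons_self _ _)
      -- A predicate that is constant along the fused wire is determined by its restriction to `V`.
      have hc : ∀ v, h (some (c v)) = h v := by
        rintro (_ | v)
        · exact hu.symm
        · rfl
      have := hπ.separate _ _ hxy (fun v => h (some v)) (by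
        intro a b hab
        obtain ⟨⟨z, l⟩, he, hz⟩ := Multiset.mem_map.1 hab
        induction z using Sym2.ind with
        | _ v w =>
          obtain ⟨h1, rfl⟩ := Prod.ext_iff.1 hz
          have hvw := hh v w (Multiset.mem_cons_of_mem he)
          rw [← hc v, ← hc w] at hvw
          rcases Sym2.eq_iff.1 h1 with ⟨h1, h2⟩ | ⟨h1, h2⟩
          · rw [← h1, ← h2]
            exact hvw
          · rw [← h1, ← h2]
            exact hvw.symm)
      simpa only [hc] using this
    · intro i j
      rw [hr]
      simp only [terminal, Function.comp_apply, ht]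
    · intro i j
      rw [hF]
      have hw : Weight.ofEdges ((Edge.wire none (some u) ::ₘ rest).map (Edge.map (π ∘ c))) =
          Weight.ofEdges ((rest.map (Edge.map c)).map (Edge.map π)) := by
        ext p q
        rw [Multiset.map_cons, Weight.ofEdges_cons, Edge.map_wire, Edge.weight_wire, zero_add,
          Multiset.map_map]
        simp only [Function.comp_def, Edge.map_map]
      have hinternal : internals (R := R) ⟨Option V, inferInstance,
          Edge.wire none (some u) ::ₘ rest, inp, out⟩ (π ∘ c) =
          internals (R := R) ⟨V, hV, rest.map (Edge.map c), fun i => (inp i).getD u, fun j => (out j).getD u⟩ π := by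
        ext q
        simp only [mem_internals, terminal, Function.comp_apply, ht]
      unfold response
      rw [hinternal]
      simp only [hw, terminal, Function.comp_apply, ht]
      rfl
  | loop V hV u rest inp out =>
    refine hD.of_edges ?_ fun x y h => Multiset.mem_cons_of_mem h
    intro Q π h
    refine ⟨?_, ?_⟩
    · intro x y hxy
      rcases Multiset.mem_cons.1 hxy with hxy | hxy
      · rcases wire_eq_wire_iff.1 hxy with ⟨rfl, rfl⟩ | ⟨rfl, rfl⟩ <;> rfl
      · exact h x y hxy
    · intro p q
      simp [Edge.map_wire, Edge.weight_wire]

open Classical in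
-- Several arms may end at one node. The mesh then behaves as if these arms had first been added up:
-- the terms `y i * y j` with ends `p` and `q` assemble to a product of two sums, and no term has `i
-- = j` since `p ≠ q`.
theorem weight_meshEdges {Q : Type} {k : ℕ} (a : Fin k → Q) (y : Fin k → Conductance R) {p q : Q}
    (hpq : p ≠ q) : (Weight.ofEdges (meshEdges a y)).val p q =
      (∑ i, if a i = p then (y i).1 else 0) * (∑ j, if a j = q then (y j).1 else 0) /
        ∑ l, (y l).1 := by
  have h1 := sum_lt_add_swap (fun i j => (if a i = p then (y i).1 else 0) *
    (if a j = q then (y j).1 else 0) / ∑ l, (y l).1) (fun i => by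
      by_cases h : a i = p
      · simp [h, hpq]
      · simp [h])
  rw [Finset.sum_mul_sum, Finset.sum_div]
  simp only [Finset.sum_div]
  rw [← h1]
  simp only [Weight.ofEdges, meshEdges, Multiset.map_map]
  refine Finset.sum_congr rfl fun x _ => ?_
  obtain ⟨i, j⟩ := x
  simp only [Function.comp_apply]
  by_cases h : s(a i, a j) = s(p, q)
  · rw [Edge.weight_of_eq hpq h]
    rcases Sym2.eq_iff.1 h with ⟨rfl, rfl⟩ | ⟨rfl, rfl⟩
    · simp [hpq.symm, Edge.resistor, Link.value, Conductance.mesh]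
    · simp [hpq.symm, Edge.resistor, Link.value, Conductance.mesh, mul_comm]
  · rw [Edge.weight_of_ne fun _ => h]
    rw [Sym2.eq_iff, not_or, not_and, not_and] at h
    by_cases h1 : a i = p <;> by_cases h2 : a j = p <;> by_cases h3 : a i = q <;>
      by_cases h4 : a j = q <;> simp_all

/-- No wire touches the centre, so it forms a class `none` of its own. Eliminating this class first
yields the weight of the mesh circuit with an added isolated node, and the other eliminations then
run in parallel on both sides. For `k = 0` all the quotients are `0 / 0 = 0`. -/
theorem starMesh_meaning {V : Type} {hV : Finite V} {k : ℕ} (a : Fin k → V)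
    (y : Fin k → Conductance R) (rest : Multiset (Edge R V)) (inp : Fin m → V) (out : Fin n → V)
    {r : Fin m ⊕ Fin n → Fin m ⊕ Fin n → Prop} {F : Fin m ⊕ Fin n → Fin m ⊕ Fin n → R}
    (hD : Meaning ⟨V, hV, meshEdges a y + rest, inp, out⟩ r F) :
    Meaning ⟨Option V, inferInstance,
      (Finset.univ : Finset (Fin k)).val.map
        (fun i => Edge.resistor none (some (a i)) (y i)) + rest.map (Edge.map some),
      fun i => some (inp i), fun j => some (out j)⟩ r F := by
  classical
  obtain ⟨Q, _, π, hπ, hr, hF⟩ := hD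
  have ht : ∀ t, Option.map π (Sum.elim (fun i => some (inp i)) (fun j => some (out j)) t) =
      some (π (Sum.elim inp out t)) := by
    rintro (i | j) <;> rfl
  refine ⟨Option Q, inferInstance, Option.map π, ⟨?_, ?_, ?_⟩, ?_, ?_⟩
  · rintro (_ | q)
    · exact ⟨none, rfl⟩
    · obtain ⟨v, rfl⟩ := hπ.surjective q
      exact ⟨some v, rfl⟩
  · intro x y' hxy
    rcases Multiset.mem_add.1 hxy with hxy | hxy
    · obtain ⟨i, -, hi⟩ := Multiset.mem_map.1 hxy
      simp [Edge.resistor, Edge.wire] at hi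
    · obtain ⟨⟨z, l⟩, he, hz⟩ := Multiset.mem_map.1 hxy
      induction z using Sym2.ind with
      | _ v w =>
        obtain ⟨h1, rfl⟩ := Prod.ext_iff.1 hz
        have hvw := hπ.glue v w (Multiset.mem_add.2 (Or.inr he))
        rcases Sym2.eq_iff.1 h1 with ⟨rfl, rfl⟩ | ⟨rfl, rfl⟩ <;> simp [hvw]
  · rintro (_ | x) (_ | x') hxy h hh
    · rfl
    · simp at hxy
    · simp at hxy
    · refine hπ.separate x x' (by simpa using hxy) (fun v => h (some v)) ?_
      intro c d hcd
      refine hh _ _ (Multiset.mem_add.2 (Or.inr ?_))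
      rcases Multiset.mem_add.1 hcd with hcd | hcd
      · obtain ⟨i, -, hi⟩ := Multiset.mem_map.1 hcd
        simp [Edge.resistor, Edge.wire] at hi
      · rw [← Edge.map_wire]
        exact Multiset.mem_map_of_mem _ hcd
  · intro i j
    rw [hr]
    simp [terminal, ht]
  · intro i j
    rw [hF]
    let wC : Weight R (Option Q) := Weight.ofEdges (((Finset.univ : Finset (Fin k)).val.map
        (fun i => Edge.resistor none (some (a i)) (y i)) + rest.map (Edge.map some)).map
          (Edge.map (Option.map π)))
    let wD : Weight R Q := Weight.ofEdges ((meshEdges a y + rest).map (Edge.map π))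
    have hEC : wC = Weight.ofEdges ((Finset.univ : Finset (Fin k)).val.map
        (fun i => Edge.resistor none (some (π (a i))) (y i)) +
          (rest.map (Edge.map π)).map (Edge.map some)) := by
      simp only [wC, Multiset.map_add, Multiset.map_map, Function.comp_def, Edge.map_map,
        Edge.map_resistor, Option.map_some, Option.map_none]
    have hED : wD = Weight.ofEdges (meshEdges (π ∘ a) y + rest.map (Edge.map π)) := by
      simp only [wD, meshEdges, Multiset.map_add, Multiset.map_map, Function.comp_def,
        Edge.map_resistor]
    have hnone : ∀ q, wC.val none (some q) = ∑ i, if π (a i) = q then (y i).1 else 0 := fun q => by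
      rw [hEC, Weight.ofEdges_add, weight_armEdges (fun i => π (a i)),
        Weight.ofEdges_map_of_notMem some _ none (some q) (by simp), add_zero]
    have hsome : ∀ p q, wC.val (some p) (some q) =
        (Weight.ofEdges (rest.map (Edge.map π))).val p q := fun p q => by
      rw [hEC, Weight.ofEdges_add, weight_armEdges_some,
        Weight.ofEdges_map some (Option.some_injective _), zero_add]
    -- Grouping the arms by their ends does not change their total, so the denominators of
    -- elimination and mesh agree.
    have hsum : ∑ z, wC.val none z = ∑ l, (y l).1 := by
      rw [Fintype.sum_option, wC.diag, zero_add]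
      simp only [hnone]
      rw [Finset.sum_comm]
      simp
    have hext : Weight.Extends some wD (wC.elim none) := by
      constructor
      · intro p q
        rcases eq_or_ne p q with rfl | hpq
        · rw [Weight.diag, Weight.diag]
        rw [Weight.elim_val_of_ne _ _ (by simp) (by simp) (by simpa using hpq), hsum, hsome,
          wC.symm (some p), hnone, hnone, hED, Weight.ofEdges_add, weight_meshEdges _ _ hpq,
          add_comm]
        rfl
      · rintro p (_ | z) hz
        · exact Weight.elim_val_right _ _ _
        · exact absurd rfl (hz z)
    have hinternal : internals (R := R) (m := m) (n := n) ⟨Option V, inferInstance,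
        (Finset.univ : Finset (Fin k)).val.map
          (fun i => Edge.resistor none (some (a i)) (y i)) + rest.map (Edge.map some),
        fun i => some (inp i), fun j => some (out j)⟩ (Option.map π) =
        insert none ((internals ⟨V, hV, meshEdges a y + rest, inp, out⟩ π).map
          ⟨some, Option.some_injective _⟩) := by
      ext z
      cases z with
      | none => simp [internals, terminal, ht]
      | some q => simp [internals, terminal, ht]
    have := (hext.elimAll (Option.some_injective _)
      (internals ⟨V, hV, meshEdges a y + rest, inp, out⟩ π)).val_map
        (π (Sum.elim inp out i)) (π (Sum.elim inp out j))
    -- Commutation of eliminations turns "centre first" into elimination of the whole set of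
    -- internal classes.
    rw [Weight.elimAll_elim, ← Weight.elimAll_insert (by simp)] at this
    unfold response
    rw [hinternal]
    simp only [terminal, ht]
    exact this.symm

/-- Apart from `starMesh`, the rules leave all weights unchanged once the wires are contracted: a
resistor parallel to a wire becomes a loop, and loops have no weight. -/
theorem ResistorRule.meaning {C D : Circuit R m n} (h : C.ResistorRule D)
    {r : Fin m ⊕ Fin n → Fin m ⊕ Fin n → Prop} {F : Fin m ⊕ Fin n → Fin m ⊕ Fin n → R}
    (hD : D.Meaning r F) : C.Meaning r F := by
  cases h with
  | shortCircuit V hV u v y rest inp out =>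
    refine hD.of_edges (fun π h => ⟨fun x y hxy => h x y ?_, fun p q => ?_⟩)
      fun x y h => Multiset.mem_cons_of_mem h
    · rcases Multiset.mem_cons.1 hxy with hxy | hxy
      · simp [Edge.wire, Edge.resistor] at hxy
      · exact hxy
    · rw [Multiset.map_cons, Weight.ofEdges_cons, Edge.map_resistor,
        h u v (Multiset.mem_cons_self _ _), Edge.weight_resistor_self, zero_add]
  | shortCircuitLoop V hV u y rest inp out =>
    refine hD.of_edges (fun π h => ⟨fun x y hxy => h x y ?_, fun p q => ?_⟩)
      fun x y h => Multiset.mem_cons_of_mem h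
    · rcases Multiset.mem_cons.1 hxy with hxy | hxy
      · simp [Edge.wire, Edge.resistor] at hxy
      · exact hxy
    · rw [Multiset.map_cons, Weight.ofEdges_cons, Edge.map_resistor, Edge.weight_resistor_self,
        zero_add]
  | parallel V hV u v y z rest inp out =>
    refine hD.of_edges (fun π h => ⟨fun x y hxy => h x y ?_, fun p q => ?_⟩)
      fun x y h => ?_
    · simpa [Edge.wire, Edge.resistor] using hxy
    · simp [Edge.map_resistor, Edge.weight_resistor_add, add_assoc]
    · simpa [Edge.wire, Edge.resistor] using h
  | starMesh V hV k a y rest inp out => exact starMesh_meaning a y rest inp out hD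

end Circuit

/-! ## Families of meshes -/

namespace Circuit

variable {R : Type u} [Semifield R] {m n : ℕ}

/-- A set of edges without wires, loops and parallel edges. -/
def IsSimple {V : Type} (E : Multiset (Edge R V)) : Prop :=
  (∀ e ∈ E, (∃ y, e.2 = Link.resistor y) ∧ ¬ e.1.IsDiag) ∧ (E.map Prod.fst).Nodup

theorem isDiag_map_iff {V W : Type} {f : V → W} (hf : Function.Injective f) (z : Sym2 V) :
    (Sym2.map f z).IsDiag ↔ z.IsDiag := by
  induction z using Sym2.ind with
  | _ a b => simp [hf.eq_iff]

theorem IsSimple.map {V W : Type} {E : Multiset (Edge R V)} (h : IsSimple E) {f : V → W}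
    (hf : Function.Injective f) : IsSimple (E.map (Edge.map f)) := by
  constructor
  · intro e he
    obtain ⟨e, he', rfl⟩ := Multiset.mem_map.1 he
    exact ⟨(h.1 e he').1, fun hd => (h.1 e he').2 ((isDiag_map_iff hf _).1 hd)⟩
  · have : (E.map (Edge.map f)).map Prod.fst = (E.map Prod.fst).map (Sym2.map f) := by
      rw [Multiset.map_map, Multiset.map_map]
      rfl
    rw [this]
    exact h.2.map (Sym2.map.injective hf)

theorem IsSimple.weight_eq {V : Type} {E : Multiset (Edge R V)} (h : IsSimple E) {e : Edge R V}
    (he : e ∈ E) {p q : V} (hpq : p ≠ q) (hs : e.1 = s(p, q)) :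
    (Weight.ofEdges E).val p q = e.2.value := by
  obtain ⟨E, rfl⟩ := Multiset.exists_cons_of_mem he
  rw [Weight.ofEdges_cons, Edge.weight_of_eq hpq hs]
  have : (Weight.ofEdges E).val p q = 0 := by
    refine Multiset.sum_eq_zero fun x hx => ?_
    obtain ⟨e', he', rfl⟩ := Multiset.mem_map.1 hx
    refine Edge.weight_of_ne fun _ hs' => ?_
    have h2 := h.2
    rw [Multiset.map_cons, Multiset.nodup_cons] at h2
    exact h2.1 (Multiset.mem_map.2 ⟨e', he', by rw [hs, hs']⟩)
  rw [this, add_zero]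

/-- Conductances are nonzero, so the weight detects whether two nodes are joined; without parallel
edges it is the conductance of the one resistor between them. -/
theorem IsSimple.mem_of_weight_eq {V : Type} {E E' : Multiset (Edge R V)} (h : IsSimple E)
    (h' : IsSimple E') (hw : ∀ p q, (Weight.ofEdges E).val p q = (Weight.ofEdges E').val p q)
    {e : Edge R V} (he : e ∈ E) : e ∈ E' := by
  obtain ⟨⟨y, hy⟩, hd⟩ := h.1 e he
  obtain ⟨z, l⟩ := e
  induction z using Sym2.ind with
  | _ p q =>
    dsimp only at hy
    subst hy
    have hpq : p ≠ q := by simpa using hd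
    have h1 := h.weight_eq he hpq rfl
    rw [hw] at h1
    have h2 : ∃ e' ∈ E', e'.weight p q ≠ 0 := by
      by_contra hcon
      push Not at hcon
      refine y.2 (h1.symm.trans ?_)
      refine Multiset.sum_eq_zero fun x hx => ?_
      obtain ⟨e', he', rfl⟩ := Multiset.mem_map.1 hx
      exact hcon e' he'
    obtain ⟨e', he', hne⟩ := h2
    have hs : e'.1 = s(p, q) := by
      by_contra hs
      exact hne (Edge.weight_of_ne fun _ => hs)
    have h3 := h'.weight_eq he' hpq hs
    obtain ⟨⟨y', hy'⟩, -⟩ := h'.1 e' he'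
    obtain ⟨z', l'⟩ := e'
    dsimp only at hy' hs
    subst hy' hs
    have : y = y' := Subtype.ext (h1.symm.trans h3)
    rwa [this]

theorem IsSimple.ext {V : Type} {E E' : Multiset (Edge R V)} (h : IsSimple E) (h' : IsSimple E')
    (hw : ∀ p q, (Weight.ofEdges E).val p q = (Weight.ofEdges E').val p q) : E = E' :=
  (Multiset.Nodup.ext (Multiset.Nodup.of_map _ h.2) (Multiset.Nodup.of_map _ h'.2)).2 fun _ =>
    ⟨h.mem_of_weight_eq h' hw, h'.mem_of_weight_eq h fun p q => (hw p q).symm⟩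

theorem IsMeshFamily.of_iso {C D : Circuit R m n} (h : C.Iso D) (hC : C.IsMeshFamily) :
    D.IsMeshFamily := by
  obtain ⟨e, he, hi, ho⟩ := h
  refine ⟨fun v => ?_, ?_⟩
  · obtain ⟨v, rfl⟩ := e.surjective v
    rcases hC.1 v with ⟨i, rfl⟩ | ⟨j, rfl⟩
    · exact Or.inl ⟨i, (hi i).symm⟩
    · exact Or.inr ⟨j, (ho j).symm⟩
  · rw [← he]
    exact IsSimple.map hC.2 e.injective

theorem IsMeshFamily.terminal_surjective {C : Circuit R m n} (hC : C.IsMeshFamily) :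
    Function.Surjective C.terminal := fun v => (C.isExternal_iff v).1 (hC.1 v)

/-- Nothing is left to contract or to eliminate: the identity is a quotient by the wires, and there
are no internal nodes. -/
theorem IsMeshFamily.meaning [PositiveRig R] {C : Circuit R m n} (hC : C.IsMeshFamily) :
    C.Meaning (fun i j => C.terminal i = C.terminal j)
      fun i j => (Weight.ofEdges C.edges).val (C.terminal i) (C.terminal j) := by
  have := C.finite_node
  let _ := Fintype.ofFinite C.Node
  refine ⟨C.Node, inferInstance, _root_.id, ⟨Function.surjective_id, ?_, ?_⟩, fun _ _ => Iff.rfl, ?_⟩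
  · intro x y hxy
    obtain ⟨⟨y, hy⟩, -⟩ := hC.2.1 _ hxy
    simp [Edge.wire] at hy
  · rintro x y rfl h -
    rfl
  · intro i j
    have hinternal : C.internals (_root_.id : C.Node → C.Node) = ∅ := by
      refine Finset.eq_empty_of_forall_notMem fun q hq => ?_
      obtain ⟨t, rfl⟩ := hC.terminal_surjective q
      exact (C.mem_internals _ _).1 hq t rfl
    have hE : C.edges.map (Edge.map _root_.id) = C.edges :=
      Edge.map_multiset_id _
    simp [response, hinternal, hE]

/-- Families of meshes are determined by their meaning. -/
theorem IsMeshFamily.iso [PositiveRig R] {C D : Circuit R m n} (hC : C.IsMeshFamily)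
    (hD : D.IsMeshFamily) {r : Fin m ⊕ Fin n → Fin m ⊕ Fin n → Prop}
    {F : Fin m ⊕ Fin n → Fin m ⊕ Fin n → R} (h : C.Meaning r F) (h' : D.Meaning r F) :
    C.Iso D := by
  obtain ⟨rfl, rfl⟩ := h.unique hC.meaning
  obtain ⟨hr, hF⟩ := h'.unique hD.meaning
  have hr : ∀ i j, C.terminal i = C.terminal j ↔ D.terminal i = D.terminal j := fun i j =>
    iff_of_eq (congrFun (congrFun hr i) j)
  have hF : ∀ i j, (Weight.ofEdges C.edges).val (C.terminal i) (C.terminal j) =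
    (Weight.ofEdges D.edges).val (D.terminal i) (D.terminal j) := fun i j =>
      congrFun (congrFun hF i) j
  -- A node is named by any terminal attached to it; the choice is immaterial since both circuits
  -- identify the same terminals.
  let f : C.Node → D.Node := fun v => D.terminal (Function.surjInv hC.terminal_surjective v)
  have hf : ∀ t, f (C.terminal t) = D.terminal t := fun t =>
    (hr _ _).1 (Function.surjInv_eq hC.terminal_surjective _)
  have hbij : Function.Bijective f := by
    constructor
    · intro p q hpq
      obtain ⟨i, rfl⟩ := hC.terminal_surjective p
      obtain ⟨j, rfl⟩ := hC.terminal_surjective q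
      rw [hf, hf] at hpq
      exact (hr i j).2 hpq
    · intro q
      obtain ⟨i, rfl⟩ := hD.terminal_surjective q
      exact ⟨_, hf i⟩
  refine ⟨Equiv.ofBijective f hbij, ?_, fun i => hf (Sum.inl i), fun j => hf (Sum.inr j)⟩
  refine (IsSimple.map hC.2 hbij.1).ext hD.2 fun p q => ?_
  obtain ⟨i, rfl⟩ := hD.terminal_surjective p
  obtain ⟨j, rfl⟩ := hD.terminal_surjective q
  rw [← hF, ← hf, ← hf]
  exact Weight.ofEdges_map f hbij.1 _ _ _

/-! ## The measure -/

open Classical in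
/-- The number of parallel members in a multiset of pairs of nodes. -/
noncomputable def parallelCount {V : Type} (S : Multiset (Sym2 V)) : ℕ :=
  (S.filter fun z => z.IsDiag ∨ 2 ≤ S.count z).card

theorem numParallel_eq (C : Circuit R m n) :
    C.numParallel = parallelCount (C.edges.map Prod.fst) := by
  classical
  unfold numParallel parallelCount
  rw [Multiset.filter_map, Multiset.card_map]
  rfl

/-- The added member is itself counted, and adding it can only raise the multiplicities of the
others. -/
theorem parallelCount_lt_cons {V : Type} (S : Multiset (Sym2 V)) (z : Sym2 V)
    (h : z.IsDiag ∨ z ∈ S) : parallelCount S < parallelCount (z ::ₘ S) := by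
  classical
  unfold parallelCount
  rw [Multiset.filter_cons_of_pos, Multiset.card_cons, Nat.lt_succ_iff]
  · refine Multiset.card_le_card (Multiset.monotone_filter_right _ fun x hx => ?_)
    refine hx.imp_right fun hx => hx.trans ?_
    exact Multiset.count_le_count_cons _ _ _
  · refine h.imp_right fun h => ?_
    rw [Multiset.count_cons_self]
    have := Multiset.one_le_count_iff_mem.2 h
    omega

theorem toLex_lt_of_numNodes_lt {C D : Circuit R m n} (h : D.numNodes < C.numNodes) :
    toLex (D.numNodes, D.numParallel) < toLex (C.numNodes, C.numParallel) :=
  Prod.Lex.toLex_lt_toLex.2 (Or.inl h)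

theorem toLex_lt_of_numParallel_lt {C D : Circuit R m n} (h : D.numNodes = C.numNodes)
    (h' : D.numParallel < C.numParallel) :
    toLex (D.numNodes, D.numParallel) < toLex (C.numNodes, C.numParallel) :=
  Prod.Lex.toLex_lt_toLex.2 (Or.inr ⟨h, h'⟩)

theorem SpiderRule.toLex_lt {C D : Circuit R m n} (h : C.SpiderRule D) :
    toLex (D.numNodes, D.numParallel) < toLex (C.numNodes, C.numParallel) := by
  cases h with
  | fuse V hV u rest inp out =>
    refine toLex_lt_of_numNodes_lt ?_
    simp only [numNodes]
    rw [Finite.card_option]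
    exact Nat.lt_succ_self _
  | loop V hV u rest inp out =>
    refine toLex_lt_of_numParallel_lt rfl ?_
    rw [numParallel_eq, numParallel_eq, Multiset.map_cons]
    exact parallelCount_lt_cons _ _ (Or.inl (by simp [Edge.wire]))

/-- A mesh may create many parallel edges, but the loss of a node takes precedence in the
lexicographic order. The other rules keep the nodes and lower the parallel count. -/
theorem ResistorRule.toLex_lt [PositiveRig R] {C D : Circuit R m n} (h : C.ResistorRule D) :
    toLex (D.numNodes, D.numParallel) < toLex (C.numNodes, C.numParallel) := by
  cases h with
  | shortCircuit V hV u v y rest inp out =>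
    refine toLex_lt_of_numParallel_lt rfl ?_
    rw [numParallel_eq, numParallel_eq, Multiset.map_cons _ (Edge.resistor u v y)]
    exact parallelCount_lt_cons _ _ (Or.inr (by simp [Edge.wire, Edge.resistor]))
  | shortCircuitLoop V hV u y rest inp out =>
    refine toLex_lt_of_numParallel_lt rfl ?_
    rw [numParallel_eq, numParallel_eq, Multiset.map_cons]
    exact parallelCount_lt_cons _ _ (Or.inl (by simp [Edge.resistor]))
  | parallel V hV u v y z rest inp out =>
    refine toLex_lt_of_numParallel_lt rfl ?_
    rw [numParallel_eq, numParallel_eq, Multiset.map_cons _ (Edge.resistor u v y)]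
    -- The count sees only the ends of edges, so combining two resistors amounts to deleting one of
    -- them.
    have h : (Edge.resistor u v (y.add z) ::ₘ rest).map Prod.fst =
        (Edge.resistor u v z ::ₘ rest).map Prod.fst := by simp [Edge.resistor]
    rw [h]
    exact parallelCount_lt_cons _ _ (Or.inr (by simp [Edge.resistor]))
  | starMesh V hV k a y rest inp out =>
    refine toLex_lt_of_numNodes_lt ?_
    simp only [numNodes]
    rw [Finite.card_option]
    exact Nat.lt_succ_self _

/-! ## Normal forms -/

theorem IsMeshFamily.not_spiderRule {C D : Circuit R m n} (hC : C.IsMeshFamily) :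
    ¬ C.SpiderRule D := by
  intro h
  cases h with
  | fuse V hV u rest inp out =>
    obtain ⟨⟨y, hy⟩, -⟩ := hC.2.1 _ (Multiset.mem_cons_self _ _)
    simp [Edge.wire] at hy
  | loop V hV u rest inp out =>
    obtain ⟨⟨y, hy⟩, -⟩ := hC.2.1 _ (Multiset.mem_cons_self _ _)
    simp [Edge.wire] at hy

theorem IsMeshFamily.not_resistorRule [PositiveRig R] {C D : Circuit R m n}
    (hC : C.IsMeshFamily) : ¬ C.ResistorRule D := by
  intro h
  cases h with
  | shortCircuit V hV u v y rest inp out =>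
    obtain ⟨⟨y, hy⟩, -⟩ :=
      hC.2.1 _ (Multiset.mem_cons_of_mem (Multiset.mem_cons_self _ _))
    simp [Edge.wire] at hy
  | shortCircuitLoop V hV u y rest inp out =>
    exact (hC.2.1 _ (Multiset.mem_cons_self _ _)).2 (by simp [Edge.resistor])
  | parallel V hV u v y z rest inp out =>
    have := hC.2.2
    simp [Edge.resistor] at this
  | starMesh V hV k a y rest inp out =>
    rcases hC.1 none with ⟨i, hi⟩ | ⟨j, hj⟩
    · simp at hi
    · simp at hj

theorem exists_step_of_edges_eq [PositiveRig R] {C : Circuit R m n}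
    {E : Multiset (Edge R C.Node)} (hE : C.edges = E)
    (h : ∃ d, (Diagram.mk ⟨C.Node, C.finite_node, E, C.inp, C.out⟩).Step d) :
    ∃ d, (Diagram.mk C).Step d := by
  subst hE
  exact h

theorem exists_step_of_wire [PositiveRig R] {C : Circuit R m n} {x y : C.Node}
    (h : Edge.wire x y ∈ C.edges) : ∃ d, (Diagram.mk C).Step d := by
  obtain ⟨E, hE⟩ := Multiset.exists_cons_of_mem h
  refine exists_step_of_edges_eq hE ?_
  by_cases hxy : y = x
  · subst hxy
    exact ⟨_, _, _, rfl, rfl, Or.inl (SpiderRule.loop _ C.finite_node y E C.inp C.out)⟩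
  · exact ⟨_, (spiderStep_fuse C.finite_node x y hxy E C.inp C.out).step⟩

theorem exists_step_of_loop [PositiveRig R] {C : Circuit R m n} {x : C.Node} {y : Conductance R}
    (h : Edge.resistor x x y ∈ C.edges) : ∃ d, (Diagram.mk C).Step d := by
  obtain ⟨E, hE⟩ := Multiset.exists_cons_of_mem h
  exact exists_step_of_edges_eq hE ⟨_, _, _, rfl, rfl,
    Or.inr (ResistorRule.shortCircuitLoop _ C.finite_node x y E C.inp C.out)⟩

theorem exists_step_of_parallel [PositiveRig R] {C : Circuit R m n} {u v : C.Node}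
    {y z : Conductance R} {E : Multiset (Edge R C.Node)}
    (hE : C.edges = Edge.resistor u v y ::ₘ Edge.resistor u v z ::ₘ E) :
    ∃ d, (Diagram.mk C).Step d :=
  exists_step_of_edges_eq hE ⟨_, _, _, rfl, rfl,
    Or.inr (ResistorRule.parallel _ C.finite_node u v y z E C.inp C.out)⟩

/-- In the absence of wires and loops, an internal node is the centre of a star. The edges are split
according to whether they touch it. -/
theorem exists_step_of_internal [PositiveRig R] {C : Circuit R m n} {x : C.Node}
    (hx : ¬ C.IsExternal x)
    (hE : ∀ e ∈ C.edges, (∃ y, e.2 = Link.resistor y) ∧ ¬ e.1.IsDiag) :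
    ∃ d, (Diagram.mk C).Step d := by
  classical
  have := C.finite_node
  let V := {v : C.Node // v ≠ x}
  let e : Option V ≃ C.Node := Equiv.optionSubtypeNe x
  have he : ∀ v, v ≠ x → ∃ v', e.symm v = some v' := fun v hv =>
    ⟨⟨v, hv⟩, Equiv.optionSubtypeNe_symm_of_ne hv⟩
  let E : Multiset (Edge R (Option V)) := C.edges.map (Edge.map e.symm)
  have hE' : ∀ e' ∈ E, (∃ y, e'.2 = Link.resistor y) ∧ ¬ e'.1.IsDiag := by
    intro e' he'
    obtain ⟨e0, he0, rfl⟩ := Multiset.mem_map.1 he'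
    exact ⟨(hE e0 he0).1, fun hd => (hE e0 he0).2 ((isDiag_map_iff e.symm.injective _).1 hd)⟩
  obtain ⟨M, hM⟩ : ∃ M : Multiset (V × Conductance R),
      M.map (fun p => Edge.resistor none (some p.1) p.2) = E.filter fun e' => none ∈ e'.1 := by
    have hc : CanLift (Edge R (Option V)) (V × Conductance R)
        (fun p => Edge.resistor none (some p.1) p.2)
        (fun e' => e' ∈ E ∧ none ∈ e'.1) := by
      constructor
      rintro ⟨z, l⟩ ⟨h1, h2⟩
      obtain ⟨⟨y, hy⟩, hd⟩ := hE' _ h1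
      obtain ⟨w, hw⟩ := Sym2.mem_iff_exists.1 h2
      dsimp only at hw hy
      subst hw hy
      cases w with
      | none => simp at hd
      | some w => exact ⟨(w, y), rfl⟩
    obtain ⟨M, hM⟩ := (Multiset.canLift (fun p : V × Conductance R =>
      (Edge.resistor none (some p.1) p.2 : Edge R (Option V))) _).prf
      (E.filter fun e' => none ∈ e'.1) (fun e' he' => Multiset.mem_filter.1 he')
    exact ⟨M, hM⟩
  obtain ⟨rest, hrest⟩ : ∃ rest : Multiset (Edge R V),
      rest.map (Edge.map some) = E.filter fun e' => none ∉ e'.1 := by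
    have hc : CanLift (Edge R (Option V)) (Edge R V) (Edge.map some)
        (fun e' => e' ∈ E ∧ none ∉ e'.1) := by
      constructor
      rintro ⟨z, l⟩ ⟨h1, h2⟩
      induction z using Sym2.ind with
      | _ a b =>
        cases a with
        | none => simp at h2
        | some a =>
          cases b with
          | none => simp at h2
          | some b => exact ⟨(s(a, b), l), rfl⟩
    obtain ⟨M, hM⟩ := (Multiset.canLift (Edge.map some : Edge R V → Edge R (Option V)) _).prf
      (E.filter fun e' => none ∉ e'.1) (fun e' he' => Multiset.mem_filter.1 he')
    exact ⟨M, hM⟩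
  -- Choosing an order of the arms provides the indexing by `Fin k` that the rule asks for.
  obtain ⟨l, rfl⟩ : ∃ l : List (V × Conductance R), M = l := ⟨M.toList, by simp⟩
  have hsplit : E = (Finset.univ : Finset (Fin l.length)).val.map
      (fun i => Edge.resistor none (some (l.get i).1) (l.get i).2) + rest.map (Edge.map some) := by
    have hl : (Finset.univ : Finset (Fin l.length)).val.map
        (fun i => Edge.resistor none (some (l.get i).1) (l.get i).2) =
        E.filter fun e' => none ∈ e'.1 := by
      rw [← hM, Fin.univ_val_map, Multiset.map_coe]
      congr 1
      exact List.ofFn_getElem_eq_map l fun p => Edge.resistor none (some p.1) p.2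
    rw [hrest, hl, Multiset.filter_add_not]
  have hinp : ∀ i, ∃ v, e.symm (C.inp i) = some v := fun i =>
    he _ fun h => hx (Or.inl ⟨i, h⟩)
  have hout : ∀ j, ∃ v, e.symm (C.out j) = some v := fun j =>
    he _ fun h => hx (Or.inr ⟨j, h⟩)
  choose inp hinp using hinp
  choose out hout using hout
  refine ⟨_, _, _, ?_, rfl, Or.inr (ResistorRule.starMesh V inferInstance l.length
    (fun i => (l.get i).1) (fun i => (l.get i).2) rest inp out)⟩
  rw [← hsplit]
  exact Diagram.mk_eq_mk_iff.2 ⟨e.symm, rfl, hinp, hout⟩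

/-- Wires and loops are excluded before internal nodes are considered, so that the star-mesh rule
applies to the latter. `shortCircuit` plays no role here, since its wire already admits a spider
step. -/
theorem exists_step_of_not_isMeshFamily [PositiveRig R] {C : Circuit R m n}
    (hC : ¬ C.IsMeshFamily) : ∃ d, (Diagram.mk C).Step d := by
  classical
  by_contra hno
  have hE : ∀ e ∈ C.edges, (∃ y, e.2 = Link.resistor y) ∧ ¬ e.1.IsDiag := by
    rintro ⟨z, l⟩ he
    induction z using Sym2.ind with
    | _ a b =>
      cases l with
      | wire => exact absurd (exists_step_of_wire he) hno
      | resistor y =>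
        refine ⟨⟨y, rfl⟩, fun hd => ?_⟩
        obtain rfl : a = b := by simpa using hd
        exact hno (exists_step_of_loop he)
  refine hC ⟨fun v => ?_, hE, ?_⟩
  · by_contra hv
    exact hno (exists_step_of_internal hv hE)
  · rw [Multiset.nodup_iff_ne_cons_cons]
    intro z S hS
    obtain ⟨e, he, rfl, h⟩ := (Multiset.map_eq_cons Prod.fst C.edges _ _).2 hS
    obtain ⟨e', he', hee', -⟩ := (Multiset.map_eq_cons Prod.fst _ _ _).2 h
    obtain ⟨⟨y, hy⟩, -⟩ := hE e he
    obtain ⟨⟨z, hz⟩, -⟩ := hE e' (Multiset.mem_of_mem_erase he')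
    have hCE : C.edges = e ::ₘ e' ::ₘ (C.edges.erase e).erase e' := by
      rw [Multiset.cons_erase he', Multiset.cons_erase he]
    obtain ⟨p, l⟩ := e
    obtain ⟨p', l'⟩ := e'
    dsimp only at hy hz hee'
    subst hy hz hee'
    induction p' using Sym2.ind with
    | _ u v => exact hno (exists_step_of_parallel hCE)

end Circuit

/-! ## Confluence -/

namespace Diagram

variable {R : Type u} [Semifield R] [PositiveRig R] {m n : ℕ}

theorem Step.toLex_lt {c d : Diagram R m n} (h : c.Step d) :
    toLex (d.numNodes, d.numParallel) < toLex (c.numNodes, c.numParallel) := by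
  obtain ⟨C, D, rfl, rfl, h | h⟩ := h
  · exact h.toLex_lt
  · exact h.toLex_lt

theorem step_terminating : Rewriting.Terminating (Step (R := R) (m := m) (n := n)) :=
  Subrelation.wf (fun {_ _} h => Step.toLex_lt h)
    (InvImage.wf (fun d : Diagram R m n => toLex (d.numNodes, d.numParallel)) wellFounded_lt)

theorem isNormal_iff (d : Diagram R m n) : Rewriting.IsNormal Step d ↔ d.IsMeshFamily := by
  constructor
  · intro h
    induction d using Quotient.inductionOn with
    | _ C =>
      refine ⟨C, rfl, ?_⟩
      by_contra hC
      obtain ⟨d, hd⟩ := Circuit.exists_step_of_not_isMeshFamily hC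
      exact h d hd
  · rintro ⟨C, rfl, hC⟩ d ⟨C', D, hCC', -, h⟩
    have hC' := hC.of_iso (mk_eq_mk_iff.1 hCC')
    rcases h with h | h
    · exact hC'.not_spiderRule h
    · exact hC'.not_resistorRule h

theorem exists_normal (d : Diagram R m n) :
    ∃ e, Relation.ReflTransGen Step d e ∧ e.IsMeshFamily := by
  induction d using WellFounded.induction (step_terminating (R := R) (m := m) (n := n)) with
  | _ d ih =>
    by_cases hd : d.IsMeshFamily
    · exact ⟨d, .refl, hd⟩
    · rw [← isNormal_iff, Rewriting.IsNormal] at hd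
      push Not at hd
      obtain ⟨d', hd'⟩ := hd
      obtain ⟨e, he, hm⟩ := ih d' hd'
      exact ⟨e, .head hd' he, hm⟩

/-- The meaning of a diagram. -/
def Meaning (d : Diagram R m n) (r : Fin m ⊕ Fin n → Fin m ⊕ Fin n → Prop)
    (F : Fin m ⊕ Fin n → Fin m ⊕ Fin n → R) : Prop :=
  ∃ C, d = mk C ∧ C.Meaning r F

theorem meaning_of_steps {c d : Diagram R m n} (h : Relation.ReflTransGen Step c d)
    {r : Fin m ⊕ Fin n → Fin m ⊕ Fin n → Prop} {F : Fin m ⊕ Fin n → Fin m ⊕ Fin n → R}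
    (hd : d.Meaning r F) : c.Meaning r F := by
  induction h using Relation.ReflTransGen.head_induction_on with
  | refl => exact hd
  | head h _ ih =>
    obtain ⟨C, D, rfl, rfl, h⟩ := h
    obtain ⟨D', hD', hm⟩ := ih
    have hm' := (mk_eq_mk_iff.1 hD').meaning hm
    rcases h with h | h
    · exact ⟨C, rfl, h.meaning hm'⟩
    · exact ⟨C, rfl, h.meaning hm'⟩

/-- Both normal forms pass their meanings back to `d`, where meanings are unique; families of meshes
with equal meanings are isomorphic. -/
theorem normal_unique {d e e' : Diagram R m n} (h : Relation.ReflTransGen Step d e)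
    (he : e.IsMeshFamily) (h' : Relation.ReflTransGen Step d e') (he' : e'.IsMeshFamily) :
    e = e' := by
  obtain ⟨C, rfl, hC⟩ := he
  obtain ⟨D, rfl, hD⟩ := he'
  obtain ⟨B, rfl, hB⟩ := meaning_of_steps h ⟨C, rfl, hC.meaning⟩
  obtain ⟨B', hBB', hB'⟩ := meaning_of_steps h' ⟨D, rfl, hD.meaning⟩
  have hB' := (mk_eq_mk_iff.1 hBB').meaning hB'
  obtain ⟨hr, hF⟩ := hB.unique hB'
  refine mk_eq_mk_iff.2 (hC.iso hD hC.meaning ?_)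
  rw [hr, hF]
  exact hD.meaning

theorem step_confluent : Rewriting.Confluent (Step (R := R) (m := m) (n := n)) := by
  intro a b c hb hc
  obtain ⟨e, he, hm⟩ := exists_normal b
  obtain ⟨e', he', hm'⟩ := exists_normal c
  obtain rfl := normal_unique (hb.trans he) hm (hc.trans he') hm'
  exact ⟨e, he, he'⟩

/-- Two rewritings of the middle term have to be joined, which is where confluence enters. -/
theorem join_trans {a b c : Diagram R m n} (h : Relation.Join (Relation.ReflTransGen Step) a b)
    (h' : Relation.Join (Relation.ReflTransGen Step) b c) :
    Relation.Join (Relation.ReflTransGen Step) a c := by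
  obtain ⟨d, had, hbd⟩ := h
  obtain ⟨e, hbe, hce⟩ := h'
  obtain ⟨f, hdf, hef⟩ := step_confluent b d e hbd hbe
  exact ⟨f, had.trans hdf, hce.trans hef⟩

end Diagram

/-! ## Rewriting in context -/

/-- A context with a hole for a circuit with `m` inputs and `n` outputs. -/
structure Context (R : Type u) [Semifield R] (m n m' n' : ℕ) where
  Node : Type
  finite_node : Finite Node
  edges : Multiset (Edge R ((Fin m ⊕ Fin n) ⊕ Node))
  inp : Fin m' → (Fin m ⊕ Fin n) ⊕ Node
  out : Fin n' → (Fin m ⊕ Fin n) ⊕ Node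

namespace Context

variable {R : Type u} [Semifield R] {m n m' n' : ℕ}

/-- The node of the filled context, for a node of the context or a terminal of the hole. -/
def place (K : Context R m n m' n') {V : Type} (inp : Fin m → V) (out : Fin n → V) :
    (Fin m ⊕ Fin n) ⊕ K.Node → V ⊕ K.Node :=
  Sum.map (Sum.elim inp out) id

theorem map_place (K : Context R m n m' n') {V W : Type} (f : V → W) (inp : Fin m → V)
    (out : Fin n → V) (x : (Fin m ⊕ Fin n) ⊕ K.Node) :
    Sum.map f id (K.place inp out x) = K.place (fun i => f (inp i)) (fun j => f (out j)) x := by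
  rcases x with (i | j) | x <;> rfl

/-- Filling the hole. -/
def plug (K : Context R m n m' n') (C : Circuit R m n) : Circuit R m' n' where
  Node := C.Node ⊕ K.Node
  finite_node := by
    have := C.finite_node
    have := K.finite_node
    infer_instance
  edges := C.edges.map (Edge.map Sum.inl) + K.edges.map (Edge.map (K.place C.inp C.out))
  inp i := K.place C.inp C.out (K.inp i)
  out j := K.place C.inp C.out (K.out j)

variable (K : Context R m n m' n')

/-- The nodes `Option V ⊕ K.Node` do not have the shape demanded by `fuse`, so that case is treated
as the contraction of a single wire. -/
theorem spiders_plug {C D : Circuit R m n} (h : C.SpiderRule D) :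
    Relation.ReflTransGen Diagram.SpiderStep (Diagram.mk (K.plug C)) (Diagram.mk (K.plug D)) := by
  have hK := K.finite_node
  cases h with
  | fuse V hV u rest inp out =>
    refine Circuit.spiders_of_contraction _ _ {(Sum.inl none, Sum.inl (some u))}
      (rest.map (Edge.map Sum.inl) + K.edges.map (Edge.map (K.place inp out))) ?_
      (Sum.map (fun v => v.getD u) id) (Sum.map some id) ?_ ?_ ?_ ?_ ?_ ?_
    · simp only [plug, Multiset.map_cons, Edge.map_wire, Multiset.cons_add]
      rfl
    · rintro (v | x) <;> rfl
    · intro p hp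
      obtain rfl := Multiset.mem_singleton.1 hp
      rfl
    · rintro ((_ | v) | x) h hh
      · exact (hh _ (Multiset.mem_singleton_self _)).symm
      · rfl
      · rfl
    · simp only [plug, Multiset.map_add, Multiset.map_map, Function.comp_def, Edge.map_map,
        map_place]
      rfl
    · intro i
      exact (K.map_place (fun v => v.getD u) inp out _).symm
    · intro j
      exact (K.map_place (fun v => v.getD u) inp out _).symm
  | loop V hV u rest inp out =>
    refine .single ⟨_, _, ?_, rfl, Circuit.SpiderRule.loop (V ⊕ K.Node) inferInstance (Sum.inl u)
      (rest.map (Edge.map Sum.inl) + K.edges.map (Edge.map (K.place inp out)))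
      (fun i => K.place inp out (K.inp i)) (fun j => K.place inp out (K.out j))⟩
    simp [plug, Edge.map_wire]

/-- The node `none` of the hole as the node `none` of the filled context. -/
def optionSum (V W : Type) : Option V ⊕ W ≃ Option (V ⊕ W) where
  toFun := Sum.elim (Option.map Sum.inl) (fun w => some (Sum.inr w))
  invFun x := x.elim (Sum.inl none) (Sum.map some id)
  left_inv := by rintro ((_ | v) | w) <;> rfl
  right_inv := by rintro (_ | (v | w)) <;> rfl

/-- The context touches the filling only at its terminals. The centre of a star is not one, so it
gains no edge and stays internal. -/
theorem step_plug [PositiveRig R] {C D : Circuit R m n} (h : C.ResistorRule D) :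
    (Diagram.mk (K.plug C)).Step (Diagram.mk (K.plug D)) := by
  have hK := K.finite_node
  cases h with
  | shortCircuit V hV u v y rest inp out =>
    refine ⟨_, _, ?_, ?_, Or.inr (Circuit.ResistorRule.shortCircuit (V ⊕ K.Node) inferInstance
      (Sum.inl u) (Sum.inl v) y
      (rest.map (Edge.map Sum.inl) + K.edges.map (Edge.map (K.place inp out)))
      (fun i => K.place inp out (K.inp i)) (fun j => K.place inp out (K.out j)))⟩ <;>
    simp [plug, Edge.map_wire, Edge.map_resistor]
  | shortCircuitLoop V hV u y rest inp out =>
    refine ⟨_, _, ?_, ?_, Or.inr (Circuit.ResistorRule.shortCircuitLoop (V ⊕ K.Node) inferInstance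
      (Sum.inl u) y
      (rest.map (Edge.map Sum.inl) + K.edges.map (Edge.map (K.place inp out)))
      (fun i => K.place inp out (K.inp i)) (fun j => K.place inp out (K.out j)))⟩ <;>
    simp [plug, Edge.map_resistor]
  | parallel V hV u v y z rest inp out =>
    refine ⟨_, _, ?_, ?_, Or.inr (Circuit.ResistorRule.parallel (V ⊕ K.Node) inferInstance
      (Sum.inl u) (Sum.inl v) y z
      (rest.map (Edge.map Sum.inl) + K.edges.map (Edge.map (K.place inp out)))
      (fun i => K.place inp out (K.inp i)) (fun j => K.place inp out (K.out j)))⟩ <;>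
    simp [plug, Edge.map_resistor]
  | starMesh V hV k a y rest inp out =>
    refine ⟨_, _, ?_, ?_, Or.inr (Circuit.ResistorRule.starMesh (V ⊕ K.Node) inferInstance k
      (fun i => Sum.inl (a i)) y
      (rest.map (Edge.map Sum.inl) + K.edges.map (Edge.map (K.place inp out)))
      (fun i => K.place inp out (K.inp i)) (fun j => K.place inp out (K.out j)))⟩
    · have hp : ∀ x, optionSum V K.Node
          (K.place (fun i => some (inp i)) (fun j => some (out j)) x) =
          some (K.place inp out x) := by
        rintro ((i | j) | x) <;> rfl
      refine Diagram.mk_eq_mk_iff.2 ⟨optionSum V K.Node, ?_, fun i => hp _, fun j => hp _⟩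
      simp only [plug, Multiset.map_add, Multiset.map_map, Function.comp_def, Edge.map_map,
        Edge.map_resistor, add_assoc]
      rw [← funext hp]
      rfl
    · simp only [plug, Multiset.map_add, Multiset.map_map, Function.comp_def, Circuit.meshEdges,
        Edge.map_resistor, add_assoc]

theorem steps_plug [PositiveRig R] {C D : Circuit R m n}
    (h : C.SpiderRule D ∨ C.ResistorRule D) :
    Relation.ReflTransGen Diagram.Step (Diagram.mk (K.plug C)) (Diagram.mk (K.plug D)) := by
  rcases h with h | h
  · exact Diagram.steps_of_spider (K.spiders_plug h)
  · exact .single (K.step_plug h)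

/-- Composition with `D` on the right. -/
def compRight (D : Circuit R n n') : Context R m n m n' where
  Node := D.Node
  finite_node := D.finite_node
  edges := D.edges.map (Edge.map Sum.inr) + (Finset.univ : Finset (Fin n)).val.map
    fun j => Edge.wire (Sum.inl (Sum.inr j)) (Sum.inr (D.inp j))
  inp i := Sum.inl (Sum.inl i)
  out j := Sum.inr (D.out j)

theorem compRight_plug (D : Circuit R n n') (C : Circuit R m n) :
    Diagram.mk (C.comp D) = Diagram.mk ((compRight D).plug C) := by
  simp only [Circuit.comp, plug, compRight, place, Multiset.map_add, Multiset.map_map,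
    Function.comp_def, Edge.map_map, Edge.map_wire, add_assoc]
  rfl

/-- Composition with `D` on the left. -/
def compLeft (D : Circuit R m' m) : Context R m n m' n where
  Node := D.Node
  finite_node := D.finite_node
  edges := D.edges.map (Edge.map Sum.inr) + (Finset.univ : Finset (Fin m)).val.map
    fun j => Edge.wire (Sum.inr (D.out j)) (Sum.inl (Sum.inl j))
  inp i := Sum.inr (D.inp i)
  out j := Sum.inl (Sum.inr j)

theorem compLeft_plug (D : Circuit R m' m) (C : Circuit R m n) :
    Diagram.mk (D.comp C) = Diagram.mk ((compLeft D).plug C) := by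
  refine Diagram.mk_eq_mk_iff.2 ⟨Equiv.sumComm _ _, ?_, fun i => rfl, fun j => rfl⟩
  simp only [Circuit.comp, plug, compLeft, place, Multiset.map_add, Multiset.map_map,
    Function.comp_def, Edge.map_map, Edge.map_wire]
  rw [← add_assoc, add_comm (Multiset.map _ D.edges)]
  rfl

/-- Tensor product with `D` on the right. -/
def tensorRight (D : Circuit R m' n') : Context R m n (m + m') (n + n') where
  Node := D.Node
  finite_node := D.finite_node
  edges := D.edges.map (Edge.map Sum.inr)
  inp := Fin.append (fun i => Sum.inl (Sum.inl i)) (fun i => Sum.inr (D.inp i))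
  out := Fin.append (fun j => Sum.inl (Sum.inr j)) (fun j => Sum.inr (D.out j))

theorem tensorRight_plug (D : Circuit R m' n') (C : Circuit R m n) :
    Diagram.mk (C.tensor D) = Diagram.mk ((tensorRight D).plug C) := by
  refine Diagram.mk_eq_mk_iff.2 ⟨Equiv.refl _, ?_, fun i => ?_, fun j => ?_⟩
  · simp only [Circuit.tensor, plug, tensorRight, Multiset.map_add, Multiset.map_map,
      Function.comp_def, Edge.map_map]
    rfl
  · refine Fin.addCases (fun i => ?_) (fun i => ?_) i <;>
      · simp only [Circuit.tensor, plug, tensorRight, place, Fin.append_left, Fin.append_right]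
        rfl
  · refine Fin.addCases (fun i => ?_) (fun i => ?_) j <;>
      · simp only [Circuit.tensor, plug, tensorRight, place, Fin.append_left, Fin.append_right]
        rfl

/-- Tensor product with `D` on the left. -/
def tensorLeft (D : Circuit R m' n') : Context R m n (m' + m) (n' + n) where
  Node := D.Node
  finite_node := D.finite_node
  edges := D.edges.map (Edge.map Sum.inr)
  inp := Fin.append (fun i => Sum.inr (D.inp i)) (fun i => Sum.inl (Sum.inl i))
  out := Fin.append (fun j => Sum.inr (D.out j)) (fun j => Sum.inl (Sum.inr j))

theorem tensorLeft_plug (D : Circuit R m' n') (C : Circuit R m n) :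
    Diagram.mk (D.tensor C) = Diagram.mk ((tensorLeft D).plug C) := by
  refine Diagram.mk_eq_mk_iff.2 ⟨Equiv.sumComm _ _, ?_, fun i => ?_, fun j => ?_⟩
  · simp only [Circuit.tensor, plug, tensorLeft, Multiset.map_add, Multiset.map_map,
      Function.comp_def, Edge.map_map]
    rw [add_comm]
    rfl
  · refine Fin.addCases (fun i => ?_) (fun i => ?_) i <;>
      · simp only [Circuit.tensor, plug, tensorLeft, place, Fin.append_left, Fin.append_right]
        rfl
  · refine Fin.addCases (fun i => ?_) (fun i => ?_) j <;>
      · simp only [Circuit.tensor, plug, tensorLeft, place, Fin.append_left, Fin.append_right]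
        rfl

end Context

namespace Diagram

variable {R : Type u} [Semifield R] [PositiveRig R] {m n k m' n' : ℕ}

/-- An operation on diagrams that is given by a context preserves rewriting. -/
theorem steps_of_context (K : Context R m n m' n') (op : Diagram R m n → Diagram R m' n')
    (hop : ∀ C, op (mk C) = mk (K.plug C)) {c c' : Diagram R m n}
    (h : Relation.ReflTransGen Step c c') : Relation.ReflTransGen Step (op c) (op c') := by
  induction h with
  | refl => exact .refl
  | tail _ h ih =>
    obtain ⟨C, D, rfl, rfl, h⟩ := h
    refine ih.trans ?_
    rw [hop, hop]
    exact K.steps_plug h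

theorem steps_comp_right {c c' : Diagram R m k} (d : Diagram R k n)
    (h : Relation.ReflTransGen Step c c') :
    Relation.ReflTransGen Step (c.comp d) (c'.comp d) := by
  induction d using Quotient.inductionOn with
  | _ D => exact steps_of_context _ (fun c => c.comp (mk D)) (Context.compRight_plug D) h

theorem steps_comp_left (d : Diagram R m k) {c c' : Diagram R k n}
    (h : Relation.ReflTransGen Step c c') :
    Relation.ReflTransGen Step (d.comp c) (d.comp c') := by
  induction d using Quotient.inductionOn with
  | _ D => exact steps_of_context _ (fun c => (mk D).comp c) (Context.compLeft_plug D) h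

theorem steps_tensor_right {c c' : Diagram R m n} (d : Diagram R m' n')
    (h : Relation.ReflTransGen Step c c') :
    Relation.ReflTransGen Step (c.tensor d) (c'.tensor d) := by
  induction d using Quotient.inductionOn with
  | _ D => exact steps_of_context _ (fun c => c.tensor (mk D)) (Context.tensorRight_plug D) h

theorem steps_tensor_left (d : Diagram R m' n') {c c' : Diagram R m n}
    (h : Relation.ReflTransGen Step c c') :
    Relation.ReflTransGen Step (d.tensor c) (d.tensor c') := by
  induction d using Quotient.inductionOn with
  | _ D => exact steps_of_context _ (fun c => (mk D).tensor c) (Context.tensorLeft_plug D) h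

end Diagram

/-! ## The identities of the category as rewritings -/

namespace Circuit

variable {R : Type u} [Semifield R] {m n k l : ℕ}

theorem spiders_id_comp (C : Circuit R m n) :
    Relation.ReflTransGen Diagram.SpiderStep (Diagram.mk ((id R m).comp C)) (Diagram.mk C) := by
  refine spiders_of_contraction _ _
    ((Finset.univ : Finset (Fin m)).val.map fun j => (Sum.inl j, Sum.inr (C.inp j)))
    (C.edges.map (Edge.map Sum.inr)) ?_ (Sum.elim C.inp _root_.id) Sum.inr (fun d => rfl) ?_ ?_ ?_
    (fun i => rfl) (fun j => rfl)
  · simp only [comp, id, Multiset.map_zero, zero_add, Multiset.map_map, Function.comp_def]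
    exact add_comm _ _
  · intro p hp
    obtain ⟨j, -, rfl⟩ := Multiset.mem_map.1 hp
    rfl
  · rintro (j | v) h hh
    · exact (hh _ (Multiset.mem_map_of_mem _ (Finset.mem_univ (α := Fin m) j))).symm
    · rfl
  · exact ((Edge.map_multiset_map (Sum.elim C.inp _root_.id) Sum.inr C.edges).trans
      (Edge.map_multiset_id C.edges)).symm

theorem spiders_comp_id (C : Circuit R m n) :
    Relation.ReflTransGen Diagram.SpiderStep (Diagram.mk (C.comp (id R n))) (Diagram.mk C) := by
  refine spiders_of_contraction _ _
    ((Finset.univ : Finset (Fin n)).val.map fun j => (Sum.inl (C.out j), Sum.inr j))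
    (C.edges.map (Edge.map Sum.inl)) ?_ (Sum.elim _root_.id C.out) Sum.inl (fun d => rfl) ?_ ?_ ?_
    (fun i => rfl) (fun j => rfl)
  · simp only [comp, id, Multiset.map_zero, add_zero, Multiset.map_map, Function.comp_def]
    exact add_comm _ _
  · intro p hp
    obtain ⟨j, -, rfl⟩ := Multiset.mem_map.1 hp
    rfl
  · rintro (v | j) h hh
    · rfl
    · exact hh _ (Multiset.mem_map_of_mem _ (Finset.mem_univ (α := Fin n) j))
  · exact ((Edge.map_multiset_map (Sum.elim _root_.id C.out) Sum.inl C.edges).trans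
      (Edge.map_multiset_id C.edges)).symm

/-- Contraction of the wires in a composite of three circuits. -/
theorem spiders_comp_comp (A : Circuit R m k) (B : Circuit R k l) (D : Circuit R l n)
    (T : Circuit R m n) (f : A.Node ⊕ (B.Node ⊕ D.Node) → T.Node)
    (g : T.Node → A.Node ⊕ (B.Node ⊕ D.Node)) (hfg : ∀ t, f (g t) = t)
    (hf : ∀ j, f (Sum.inl (A.out j)) = f (Sum.inr (Sum.inl (B.inp j))))
    (hf' : ∀ j, f (Sum.inr (Sum.inl (B.out j))) = f (Sum.inr (Sum.inr (D.inp j))))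
    (hg : ∀ x, ∀ h : A.Node ⊕ (B.Node ⊕ D.Node) → Prop,
      (∀ j, h (Sum.inl (A.out j)) = h (Sum.inr (Sum.inl (B.inp j)))) →
      (∀ j, h (Sum.inr (Sum.inl (B.out j))) = h (Sum.inr (Sum.inr (D.inp j)))) →
      h (g (f x)) = h x)
    (hE : T.edges = A.edges.map (Edge.map fun a => f (Sum.inl a)) +
      B.edges.map (Edge.map fun b => f (Sum.inr (Sum.inl b))) +
      D.edges.map (Edge.map fun d => f (Sum.inr (Sum.inr d))))
    (hi : ∀ i, T.inp i = f (Sum.inl (A.inp i)))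
    (ho : ∀ j, T.out j = f (Sum.inr (Sum.inr (D.out j)))) :
    Relation.ReflTransGen Diagram.SpiderStep (Diagram.mk (A.comp (B.comp D))) (Diagram.mk T) := by
  refine spiders_of_contraction _ _
    (((Finset.univ : Finset (Fin k)).val.map fun j =>
        (Sum.inl (A.out j), Sum.inr (Sum.inl (B.inp j)))) +
      (Finset.univ : Finset (Fin l)).val.map fun j =>
        (Sum.inr (Sum.inl (B.out j)), Sum.inr (Sum.inr (D.inp j))))
    (A.edges.map (Edge.map Sum.inl) + B.edges.map (Edge.map (Sum.inr ∘ Sum.inl)) +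
      D.edges.map (Edge.map (Sum.inr ∘ Sum.inr))) ?_ f g hfg ?_ ?_ ?_ hi ho
  · simp only [comp, Multiset.map_add, Multiset.map_map, Function.comp_def, Edge.map_map,
      Edge.map_wire]
    have h : ∀ a b c d e : Multiset (Edge R (A.Node ⊕ B.Node ⊕ D.Node)),
        a + (b + c + d) + e = e + d + (a + b + c) := fun a b c d e => by abel
    exact h _ _ _ _ _
  · intro p hp
    rcases Multiset.mem_add.1 hp with hp | hp
    · obtain ⟨j, -, rfl⟩ := Multiset.mem_map.1 hp
      exact hf j
    · obtain ⟨j, -, rfl⟩ := Multiset.mem_map.1 hp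
      exact hf' j
  · intro x h hh
    refine hg x h (fun j => ?_) fun j => ?_
    · exact hh _ (Multiset.mem_add.2 (Or.inl
        (Multiset.mem_map_of_mem _ (Finset.mem_univ j))))
    · exact hh _ (Multiset.mem_add.2 (Or.inr
        (Multiset.mem_map_of_mem _ (Finset.mem_univ j))))
  · have key : (A.edges.map (Edge.map Sum.inl) + B.edges.map (Edge.map (Sum.inr ∘ Sum.inl)) +
        D.edges.map (Edge.map (Sum.inr ∘ Sum.inr))).map (Edge.map f) = T.edges := by
      rw [hE]
      simp only [Multiset.map_add, Multiset.map_map, Function.comp_def, Edge.map_map]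
    exact key.symm

theorem spiders_selfAdjoint (y : Conductance R) :
    Relation.ReflTransGen Diagram.SpiderStep
      (Diagram.mk (m := 1) (n := 1) (((id R 1).tensor (junction R 0 2)).comp
          ((((id R 1).tensor (conductance y)).tensor (id R 1)).comp
            ((junction R 2 0).tensor (id R 1)))))
      (Diagram.mk (conductance y)) := by
  refine spiders_comp_comp (m := 1) (n := 1) _ _ _ _
    -- Bending both legs exchanges the ends of the resistor, hence the negation on its nodes. Edges
    -- being unordered pairs, `Sym2.eq_swap` undoes this below.
    (Sum.elim (Sum.elim (fun _ => false) (fun _ => true))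
      (Sum.elim (Sum.elim (Sum.elim (fun _ => false) (fun b => !b)) (fun _ => true))
        (Sum.elim (fun _ => false) (fun _ => true))))
    (fun b : Bool => if b then Sum.inl (Sum.inr ()) else Sum.inl (Sum.inl (0 : Fin 1))) ?_ ?_ ?_ ?_ ?_ ?_ ?_
  · rintro (_ | _) <;> rfl
  · intro j
    change Fin 3 at j
    fin_cases j <;> rfl
  · intro j
    change Fin 3 at j
    fin_cases j <;> rfl
  · intro x h hA hD
    have a0 : h (Sum.inl (Sum.inl (0 : Fin 1))) = h (Sum.inr (Sum.inl (Sum.inl (Sum.inl (0 : Fin 1))))) :=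
      hA (0 : Fin 3)
    have a1 : h (Sum.inl (Sum.inr ())) = h (Sum.inr (Sum.inl (Sum.inl (Sum.inr false)))) :=
      hA (1 : Fin 3)
    have a2 : h (Sum.inl (Sum.inr ())) = h (Sum.inr (Sum.inl (Sum.inr (0 : Fin 1)))) := hA (2 : Fin 3)
    have d0 : h (Sum.inr (Sum.inl (Sum.inl (Sum.inl (0 : Fin 1))))) = h (Sum.inr (Sum.inr (Sum.inl ()))) :=
      hD (0 : Fin 3)
    have d1 : h (Sum.inr (Sum.inl (Sum.inl (Sum.inr true)))) =
      h (Sum.inr (Sum.inr (Sum.inl ()))) := hD (1 : Fin 3)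
    have d2 : h (Sum.inr (Sum.inl (Sum.inr (0 : Fin 1)))) = h (Sum.inr (Sum.inr (Sum.inr (0 : Fin 1)))) :=
      hD (2 : Fin 3)
    rcases x with (x | x) | ((x | x) | x) | (x | x)
    · obtain rfl : x = (0 : Fin 1) := Subsingleton.elim (α := Fin 1) _ _
      rfl
    · rfl
    · obtain rfl : x = (0 : Fin 1) := Subsingleton.elim (α := Fin 1) _ _
      exact a0
    · cases x
      · exact a1
      · exact a0.trans (d0.trans d1.symm)
    · obtain rfl : x = (0 : Fin 1) := Subsingleton.elim (α := Fin 1) _ _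
      exact a2
    · exact a0.trans d0
    · obtain rfl : x = (0 : Fin 1) := Subsingleton.elim (α := Fin 1) _ _
      exact a2.trans d2
  · simp [tensor, id, junction, conductance, Edge.map_resistor]
    rw [Edge.resistor, Sym2.eq_swap]
    exact ((add_zero _).trans (zero_add _)).symm
  · intro i
    change Fin 1 at i
    fin_cases i
    rfl
  · intro i
    change Fin 1 at i
    fin_cases i
    rfl

/-- Resistors in parallel. -/
def parallelPair (y z : Conductance R) : Circuit R 1 1 :=
  ⟨Bool, inferInstance, {Edge.resistor false true y, Edge.resistor false true z},
    fun _ => false, fun _ => true⟩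

/-- A resistor from a junction to itself. -/
def shorted (y : Conductance R) : Circuit R 1 1 :=
  ⟨Unit, inferInstance, {Edge.resistor () () y}, fun _ => (), fun _ => ()⟩

theorem spiders_parallel (y z : Conductance R) :
    Relation.ReflTransGen Diagram.SpiderStep
      (Diagram.mk ((junction R 1 2).comp (((conductance y).tensor (conductance z)).comp
        (junction R 2 1))))
      (Diagram.mk (parallelPair y z)) := by
  refine spiders_comp_comp (k := 2) (l := 2) _ _ _ _
    (Sum.elim (fun _ => false) (Sum.elim (Sum.elim _root_.id _root_.id) (fun _ => true)))
    (fun b : Bool => if b then Sum.inr (Sum.inr ()) else Sum.inl ()) ?_ ?_ ?_ ?_ ?_ ?_ ?_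
  · rintro (_ | _) <;> rfl
  · intro j
    fin_cases j <;> rfl
  · intro j
    fin_cases j <;> rfl
  · intro x h hA hD
    have a0 : h (Sum.inl ()) = h (Sum.inr (Sum.inl (Sum.inl false))) := hA 0
    have a1 : h (Sum.inl ()) = h (Sum.inr (Sum.inl (Sum.inr false))) := hA 1
    have d0 : h (Sum.inr (Sum.inl (Sum.inl true))) = h (Sum.inr (Sum.inr ())) := hD 0
    have d1 : h (Sum.inr (Sum.inl (Sum.inr true))) = h (Sum.inr (Sum.inr ())) := hD 1
    rcases x with x | ((_ | _) | (_ | _)) | x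
    · rfl
    · exact a0
    · exact d0.symm
    · exact a1
    · exact d1.symm
    · rfl
  · simp [tensor, junction, conductance, Edge.map_resistor, parallelPair]
    exact ((add_zero _).trans (zero_add _)).symm
  · intro i
    rfl
  · intro i
    rfl

/-- The parallel wire joins the two ends, so all nodes collapse to one and the resistor becomes a
loop. -/
theorem spiders_shortCircuit (y : Conductance R) :
    Relation.ReflTransGen Diagram.SpiderStep
      (Diagram.mk ((junction R 1 2).comp (((conductance y).tensor (id R 1)).comp
        (junction R 2 1))))
      (Diagram.mk (shorted y)) := by
  refine spiders_comp_comp (k := 2) (l := 2) _ _ _ _ (fun _ => ()) (fun _ => Sum.inl ()) ?_ ?_ ?_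
    ?_ ?_ ?_ ?_
  · intro t
    rfl
  · intro j
    rfl
  · intro j
    rfl
  · intro x h hA hD
    have a0 : h (Sum.inl ()) = h (Sum.inr (Sum.inl (Sum.inl false))) := hA 0
    have a1 : h (Sum.inl ()) = h (Sum.inr (Sum.inl (Sum.inr (0 : Fin 1)))) := hA 1
    have d0 : h (Sum.inr (Sum.inl (Sum.inl true))) = h (Sum.inr (Sum.inr ())) := hD 0
    have d1 : h (Sum.inr (Sum.inl (Sum.inr (0 : Fin 1)))) = h (Sum.inr (Sum.inr ())) := hD 1
    rcases x with x | ((_ | _) | x) | x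
    · rfl
    · exact a0
    · exact (a1.trans d1).trans d0.symm
    · obtain rfl : x = (0 : Fin 1) := Subsingleton.elim (α := Fin 1) _ _
      exact a1
    · exact a1.trans d1
  · simp [tensor, id, junction, conductance, Edge.map_resistor, shorted]
    exact ((add_zero _).trans (zero_add _)).symm
  · intro i
    rfl
  · intro i
    rfl

theorem mk_junction_one : Diagram.mk (junction R 1 1) = Diagram.id R 1 :=
  Diagram.mk_eq_mk_iff.2 ⟨⟨fun _ => (0 : Fin 1), fun _ => (), fun _ => rfl,
    fun _ => Subsingleton.elim (α := Fin 1) _ _⟩, rfl, fun _ => Subsingleton.elim (α := Fin 1) _ _,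
      fun _ => Subsingleton.elim (α := Fin 1) _ _⟩

theorem step_star [PositiveRig R] (y : Fin n → Conductance R) :
    (Diagram.mk (star y)).Step (Diagram.mk (mesh y)) := by
  refine ⟨_, _, ?_, ?_, Or.inr (ResistorRule.starMesh (Fin n) inferInstance n (fun i => i) y 0
    (fun i => i.elim0) fun i => i)⟩
  · refine Diagram.mk_eq_mk_iff.2 ⟨Equiv.refl _, ?_, fun i => i.elim0, fun j => rfl⟩
    simp only [Multiset.map_zero, add_zero]
    exact Edge.map_multiset_id _
  · rw [add_zero]
    rfl

end Circuit

namespace Diagram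

variable {R : Type u} [Semifield R] [PositiveRig R] {m n : ℕ}

theorem join_of_steps {c d : Diagram R m n} (h : Relation.ReflTransGen Step c d) :
    Relation.Join (Relation.ReflTransGen Step) c d := ⟨d, h, .refl⟩

/-- Each generating identity is a rewriting from left to right, so only the closure properties of
joinability are at stake: contexts give the congruences, and `join_trans` gives transitivity. -/
theorem join_of_equal {c d : Diagram R m n} (h : Equal c d) :
    Relation.Join (Relation.ReflTransGen Step) c d := by
  induction h with
  | refl c => exact ⟨c, .refl, .refl⟩
  | symm _ ih =>
    obtain ⟨e, h1, h2⟩ := ih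
    exact ⟨e, h2, h1⟩
  | trans _ _ ih ih' => exact join_trans ih ih'
  | comp_congr _ _ ih ih' =>
    obtain ⟨e, h1, h2⟩ := ih
    obtain ⟨f, h3, h4⟩ := ih'
    exact ⟨e.comp f, (steps_comp_right _ h1).trans (steps_comp_left _ h3),
      (steps_comp_right _ h2).trans (steps_comp_left _ h4)⟩
  | tensor_congr _ _ ih ih' =>
    obtain ⟨e, h1, h2⟩ := ih
    obtain ⟨f, h3, h4⟩ := ih'
    exact ⟨e.tensor f, (steps_tensor_right _ h1).trans (steps_tensor_left _ h3),
      (steps_tensor_right _ h2).trans (steps_tensor_left _ h4)⟩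
  | id_comp c =>
    induction c using Quotient.inductionOn with
    | _ C => exact join_of_steps (steps_of_spider (Circuit.spiders_id_comp C))
  | comp_id c =>
    induction c using Quotient.inductionOn with
    | _ C => exact join_of_steps (steps_of_spider (Circuit.spiders_comp_id C))
  | spider h => exact join_of_steps (.single ⟨_, _, rfl, rfl, Or.inl h⟩)
  | selfAdjoint y => exact join_of_steps (steps_of_spider (Circuit.spiders_selfAdjoint y))
  | shortCircuit y =>
    refine join_of_steps ((steps_of_spider (Circuit.spiders_shortCircuit y)).tail ?_)
    rw [← Circuit.mk_junction_one]
    exact ⟨_, _, rfl, rfl, Or.inr (Circuit.ResistorRule.shortCircuitLoop Unit inferInstance () y 0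
      (fun _ => ()) fun _ => ())⟩
  | parallel y z =>
    refine join_of_steps ((steps_of_spider (Circuit.spiders_parallel y z)).tail ?_)
    exact ⟨_, _, rfl, rfl, Or.inr (Circuit.ResistorRule.parallel Bool inferInstance false true y z 0
      (fun _ => false) fun _ => true)⟩
  | starMesh y => exact join_of_steps (.single (Circuit.step_star y))

end Diagram

/-! ## Rewriting steps are equalities -/

namespace Circuit

variable {R : Type u} [Semifield R] {m n p q : ℕ}

/-- A circuit with nodes `V` and a hole whose terminals are at the nodes `a` and `b`, filled by
`S`, as a composite. -/
noncomputable def host {V : Type} (hV : Finite V) (E : Multiset (Edge R V)) (inp : Fin m → V)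
    (out : Fin n → V) (a : Fin p → V) (b : Fin q → V) (S : Diagram R p q) : Diagram R m n :=
  (Diagram.mk ⟨V, hV, E, inp, Fin.append a (Finite.equivFin V).symm⟩).comp
    ((S.tensor (Diagram.id R (Nat.card V))).comp
      (Diagram.mk ⟨V, hV, 0, Fin.append b (Finite.equivFin V).symm, out⟩))

/-- The host holds two copies of `V`, joined node by node through identity strands that run beside
`S`. Contraction glues the copies and puts the terminals of `S` at the nodes `a i` and `b j`; by
`hφ` the internal nodes of `S` survive as separate nodes. -/
theorem spiders_host {V : Type} (hV : Finite V) (E : Multiset (Edge R V)) (inp : Fin m → V)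
    (out : Fin n → V) (a : Fin p → V) (b : Fin q → V) (S : Circuit R p q) (T : Circuit R m n)
    (ι : V → T.Node) (φ : S.Node → T.Node) (g : T.Node → V ⊕ S.Node)
    (hg : ∀ t, Sum.elim ι φ (g t) = t) (hι : ∀ v, g (ι v) = Sum.inl v)
    (hφ : ∀ s, S.IsExternal s ∨ g (φ s) = Sum.inr s) (ha : ∀ i, φ (S.inp i) = ι (a i))
    (hb : ∀ j, φ (S.out j) = ι (b j))
    (hE : T.edges = S.edges.map (Edge.map φ) + E.map (Edge.map ι))
    (hi : ∀ i, T.inp i = ι (inp i)) (ho : ∀ j, T.out j = ι (out j)) :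
    Relation.ReflTransGen Diagram.SpiderStep (host hV E inp out a b (Diagram.mk S))
      (Diagram.mk T) := by
  refine spiders_comp_comp _ (S.tensor (id R (Nat.card V))) _ T
    (Sum.elim ι (Sum.elim (Sum.elim φ fun i => ι ((Finite.equivFin V).symm i)) ι))
    (fun t => Sum.map _root_.id (fun s => Sum.inl (Sum.inl s)) (g t)) ?_ ?_ ?_ ?_ ?_ hi ho
  · intro t
    conv_rhs => rw [← hg t]
    rcases g t with v | s <;> rfl
  · intro j
    refine Fin.addCases (fun j => ?_) (fun j => ?_) j
    · simp [tensor, ha]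
    · simp [tensor, id]
  · intro j
    refine Fin.addCases (fun j => ?_) (fun j => ?_) j
    · simp [tensor, hb]
    · simp [tensor, id]
  · intro x h hA hD
    have hA1 : ∀ i, h (Sum.inl (a i)) = h (Sum.inr (Sum.inl (Sum.inl (S.inp i)))) := fun i => by
      have := hA (Fin.castAdd _ i)
      simpa [tensor] using this
    have hA2 : ∀ i, h (Sum.inl ((Finite.equivFin V).symm i)) =
        h (Sum.inr (Sum.inl (Sum.inr i))) := fun i => by
      have := hA (Fin.natAdd _ i)
      simpa [tensor, id] using this
    have hD1 : ∀ j, h (Sum.inr (Sum.inl (Sum.inl (S.out j)))) = h (Sum.inr (Sum.inr (b j))) :=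
      fun j => by
        have := hD (Fin.castAdd _ j)
        simpa [tensor] using this
    have hD2 : ∀ i : Fin (Nat.card V), h (Sum.inr (Sum.inl (Sum.inr i))) =
        h (Sum.inr (Sum.inr ((Finite.equivFin V).symm i))) := fun i =>
      (congrArg (fun z => h (Sum.inr (Sum.inl z)))
        (Fin.append_right (fun j => Sum.inl (S.out j)) (fun j => Sum.inr j) i)).symm.trans
        ((hD (Fin.natAdd _ i)).trans
          (congrArg (fun z => h (Sum.inr (Sum.inr z))) (Fin.append_right _ _ i)))
    -- Follow the strand of `v` from the first copy of `V` to the second.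
    have hV' : ∀ v, h (Sum.inl v) = h (Sum.inr (Sum.inr v)) := fun v => by
      obtain ⟨i, rfl⟩ := (Finite.equivFin V).symm.surjective v
      exact (hA2 i).trans (hD2 i)
    have hG : ∀ t z, g t = z → h (Sum.map _root_.id (fun s => Sum.inl (Sum.inl s)) (g t)) =
        h (Sum.map _root_.id (fun s => Sum.inl (Sum.inl s)) z) := fun t z e => by rw [e]
    rcases x with v | (s | i) | v
    · exact hG (ι v) _ (hι v)
    · rcases hφ s with (⟨i, rfl⟩ | ⟨j, rfl⟩) | hs
      · exact (hG (φ (S.inp i)) (Sum.inl (a i)) (by rw [ha, hι])).trans (hA1 i)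
      · exact (hG (φ (S.out j)) (Sum.inl (b j)) (by rw [hb, hι])).trans
          ((hV' _).trans (hD1 j).symm)
      · exact hG (φ s) _ hs
    · exact (hG (ι _) _ (hι _)).trans (hA2 i)
    · exact (hG (ι v) _ (hι v)).trans (hV' v)
  · rw [hE]
    simp only [tensor, id, Multiset.map_zero, add_zero, Multiset.map_map, Function.comp_def,
      Edge.map_map]
    exact add_comm _ _

end Circuit

namespace Diagram

variable {R : Type u} [Semifield R] [PositiveRig R] {m n p q : ℕ}

theorem Equal.host {V : Type} (hV : Finite V) (E : Multiset (Edge R V)) (inp : Fin m → V)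
    (out : Fin n → V) (a : Fin p → V) (b : Fin q → V) {S S' : Diagram R p q} (h : Equal S S') :
    Equal (Circuit.host hV E inp out a b S) (Circuit.host hV E inp out a b S') :=
  Equal.comp_congr (Equal.refl _)
    (Equal.comp_congr (Equal.tensor_congr h (Equal.refl _)) (Equal.refl _))

/-- A circuit all of whose nodes are terminals, in a host. -/
theorem equal_host {V : Type} (hV : Finite V) (E : Multiset (Edge R V)) (inp : Fin m → V)
    (out : Fin n → V) (a : Fin p → V) (b : Fin q → V) (S : Circuit R p q) (φ : S.Node → V)
    (hS : ∀ s, S.IsExternal s) (ha : ∀ i, φ (S.inp i) = a i) (hb : ∀ j, φ (S.out j) = b j) :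
    Equal (Circuit.host hV E inp out a b (mk S))
      (mk ⟨V, hV, S.edges.map (Edge.map φ) + E, inp, out⟩) :=
  equal_of_spider (Circuit.spiders_host hV E inp out a b S _ _root_.id φ Sum.inl (fun _ => rfl)
    (fun _ => rfl) (fun s => Or.inl (hS s)) ha hb
    (congrArg (S.edges.map (Edge.map φ) + ·) (Edge.map_multiset_id E).symm) (fun _ => rfl) fun _ => rfl)

theorem equal_shorted (y : Conductance R) :
    Equal (mk (Circuit.shorted y)) (mk (Circuit.junction R 1 1)) := by
  rw [Circuit.mk_junction_one]
  exact (equal_of_spider (Circuit.spiders_shortCircuit y)).symm.trans (Equal.shortCircuit y)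

theorem equal_parallelPair (y z : Conductance R) :
    Equal (mk (Circuit.parallelPair y z)) (mk (Circuit.conductance (y.add z))) :=
  (equal_of_spider (Circuit.spiders_parallel y z)).symm.trans (Equal.parallel y z)

/-- A wire and other edges between two nodes. -/
def wireAnd (E : Multiset (Edge R Bool)) : Circuit R 1 1 :=
  ⟨Bool, inferInstance, Edge.wire false true ::ₘ E, fun _ => false, fun _ => true⟩

theorem equal_wireAnd (E : Multiset (Edge R Bool)) :
    Equal (mk (wireAnd E))
      (mk ⟨Unit, inferInstance, E.map (Edge.map fun _ => ()), fun _ => (), fun _ => ()⟩) := by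
  refine equal_of_spider (Circuit.spiders_of_contraction _ _ {(false, true)} E ?_ (fun _ => ())
    (fun _ => false) (fun _ => rfl) (fun _ _ => rfl) ?_ rfl (fun _ => rfl) fun _ => rfl)
  · rfl
  · rintro (_ | _) h hh
    · rfl
    · exact hh _ (Multiset.mem_singleton_self _)

/-- Fusing the wire on both sides reduces this to the removal of a loop, which is the contracted
form of the generator `Equal.shortCircuit`. -/
theorem equal_resistor_wire (y : Conductance R) :
    Equal (mk (wireAnd {Edge.resistor false true y})) (mk (wireAnd 0)) :=
  (equal_wireAnd _).trans ((equal_shorted y).trans (equal_wireAnd 0).symm)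

/-- Each rule is first an equality of two small circuits whose terminals are the nodes where the
surroundings attach. Both are placed in the same host, where congruence applies, and spider
identities turn the two hosts into `C` and `D`. -/
theorem equal_of_resistorRule {C D : Circuit R m n} (h : C.ResistorRule D) :
    Equal (mk C) (mk D) := by
  have hbool : ∀ E : Multiset (Edge R Bool), ∀ s : Bool,
      Circuit.IsExternal (R := R) (m := 1) (n := 1)
        ⟨Bool, inferInstance, E, fun _ => false, fun _ => true⟩ s := by
    rintro E (_ | _)
    · exact Or.inl ⟨0, rfl⟩
    · exact Or.inr ⟨0, rfl⟩
  cases h with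
  | shortCircuit V hV u v y rest inp out =>
    have h := (equal_resistor_wire y).host hV rest inp out (fun _ => u) (fun _ => v)
    have h1 := equal_host hV rest inp out (fun _ => u) (fun _ => v)
      (wireAnd {Edge.resistor false true y}) (fun s : Bool => if s then v else u) (hbool _)
      (fun _ => rfl) (fun _ => rfl)
    have h2 := equal_host hV rest inp out (fun _ => u) (fun _ => v)
      (wireAnd 0) (fun s : Bool => if s then v else u) (hbool _)
      (fun _ => rfl) (fun _ => rfl)
    have h3 := h1.symm.trans (h.trans h2)
    simp only [wireAnd, Multiset.map_cons, Edge.map_wire, Multiset.map_singleton, Edge.map_resistor,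
      Multiset.map_zero, Multiset.cons_add, Multiset.singleton_add, zero_add] at h3
    rw [Multiset.cons_swap]
    exact h3
  | shortCircuitLoop V hV u y rest inp out =>
    have h := (equal_shorted y).host hV rest inp out (fun _ => u) (fun _ => u)
    have h1 := equal_host hV rest inp out (fun _ => u) (fun _ => u)
      (Circuit.shorted y) (fun _ => u) (fun _ => Or.inl ⟨0, rfl⟩) (fun _ => rfl) (fun _ => rfl)
    have h2 := equal_host hV rest inp out (fun _ => u) (fun _ => u)
      (Circuit.junction R 1 1) (fun _ => u) (fun _ => Or.inl ⟨0, rfl⟩) (fun _ => rfl)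
      (fun _ => rfl)
    have h3 := h1.symm.trans (h.trans h2)
    simp only [Circuit.shorted, Circuit.junction, Multiset.map_singleton, Edge.map_resistor,
      Multiset.map_zero, Multiset.singleton_add, zero_add] at h3
    exact h3
  | parallel V hV u v y z rest inp out =>
    have h := (equal_parallelPair y z).host hV rest inp out (fun _ => u) (fun _ => v)
    have h1 := equal_host hV rest inp out (fun _ => u) (fun _ => v)
      (Circuit.parallelPair y z) (fun s : Bool => if s then v else u) (hbool _)
      (fun _ => rfl) (fun _ => rfl)
    have h2 := equal_host hV rest inp out (fun _ => u) (fun _ => v)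
      (Circuit.conductance (y.add z)) (fun s : Bool => if s then v else u) (hbool _)
      (fun _ => rfl) (fun _ => rfl)
    have h3 := h1.symm.trans (h.trans h2)
    simp only [Circuit.parallelPair, Circuit.conductance, Multiset.insert_eq_cons,
      Multiset.map_cons, Multiset.map_singleton, Edge.map_resistor, Multiset.cons_add,
      Multiset.singleton_add] at h3
    exact h3
  | starMesh V hV k a y rest inp out =>
    have h := (Equal.starMesh y).host hV rest inp out (fun i => i.elim0) a
    have h1 := equal_of_spider (Circuit.spiders_host hV rest inp out (fun i => i.elim0) a
      (Circuit.star y) ⟨Option V, inferInstance,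
          (Finset.univ : Finset (Fin k)).val.map
            (fun i => Edge.resistor none (some (a i)) (y i)) + rest.map (Edge.map some),
          fun i => some (inp i), fun j => some (out j)⟩ some (Option.map a)
      -- The centre is the only node of the filled circuit that comes from the star alone; the
      -- others are nodes of the host.
      (fun t => t.elim (Sum.inr none) Sum.inl) (by rintro (_ | t) <;> rfl) (fun _ => rfl)
      (by
        rintro (_ | s)
        · exact Or.inr rfl
        · exact Or.inl (Or.inr ⟨s, rfl⟩))
      (fun i => i.elim0) (fun _ => rfl)
      (by
        simp only [Circuit.star, Multiset.map_map, Function.comp_def, Edge.map_resistor]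
        rfl)
      (fun _ => rfl) (fun _ => rfl))
    have h2 := equal_host hV rest inp out (fun i => i.elim0) a
      (Circuit.mesh y) a (fun s => Or.inr ⟨s, rfl⟩) (fun i => i.elim0) (fun _ => rfl)
    have h3 := h1.symm.trans (h.trans h2)
    simp only [Circuit.mesh, Circuit.meshEdges, Multiset.map_map, Function.comp_def,
      Edge.map_resistor] at h3
    exact h3

theorem Step.equal {c d : Diagram R m n} (h : c.Step d) : Equal c d := by
  obtain ⟨C, D, rfl, rfl, h | h⟩ := h
  · exact Equal.spider h
  · exact equal_of_resistorRule h

theorem equal_of_steps {c d : Diagram R m n} (h : Relation.ReflTransGen Step c d) :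
    Equal c d := by
  induction h with
  | refl => exact Equal.refl _
  | tail _ h ih => exact ih.trans h.equal

end Diagram

/-! ### Conclusion. -/

theorem Resist.ofDiagram_eq_iff {R : Type u} [Semifield R] [PositiveRig R] {m n : ℕ}
    {c d : Diagram R m n} :
    Resist.ofDiagram c = Resist.ofDiagram d ↔ Diagram.Equal c d :=
  ⟨fun h => Quotient.exact (s := Resist.setoid R m n) h,
    fun h => Quotient.sound (s := Resist.setoid R m n) h⟩

theorem mainTheorem1 {R : Type u} [Semifield R] [PositiveRig R] (m n : ℕ) :
    (∀ c d : Diagram R m n, c.Step d →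
      toLex (d.numNodes, d.numParallel) < toLex (c.numNodes, c.numParallel)) ∧
    Rewriting.Terminating (Diagram.Step (R := R) (m := m) (n := n)) ∧
    Rewriting.LocallyConfluent (Diagram.Step (R := R) (m := m) (n := n)) ∧
    Rewriting.Confluent (Diagram.Step (R := R) (m := m) (n := n)) ∧
    (∀ d : Diagram R m n, Rewriting.IsNormal Diagram.Step d ↔ d.IsMeshFamily) ∧
    (∀ d : Diagram R m n, ∃! e, Relation.ReflTransGen Diagram.Step d e ∧ e.IsMeshFamily) ∧
    (∀ c d : Diagram R m n, Resist.ofDiagram c = Resist.ofDiagram d ↔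
      Relation.Join (Relation.ReflTransGen Diagram.Step) c d) := by
  refine ⟨fun c d h => h.toLex_lt, Diagram.step_terminating,
    -- Local confluence is obtained as a special case of confluence, which rests on the unique
    -- normal forms.
    fun a b c hb hc => Diagram.step_confluent a b c (.single hb) (.single hc),
    Diagram.step_confluent, Diagram.isNormal_iff, fun d => ?_, fun c d => ?_⟩
  · obtain ⟨e, he, hm⟩ := Diagram.exists_normal d
    exact ⟨e, ⟨he, hm⟩, fun e' he' => Diagram.normal_unique he'.1 he'.2 he hm⟩
  · rw [Resist.ofDiagram_eq_iff]
    refine ⟨Diagram.join_of_equal, ?_⟩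
    rintro ⟨e, hc, hd⟩
    exact (Diagram.equal_of_steps hc).trans (Diagram.equal_of_steps hd).symm
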